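/- Let $k\ge 0$, let $p_0,\dots,p_k$ be distinct primes, and let $n=p_0\cdots p_k$. Let $Y=\mathbb{Z}_{p_0}*\cdots*\mathbb{Z}_{p_k}$ be the simplicial join of the discrete sets $\mathbb{Z}_{p_i}=\mathbb{Z}/p_i\mathbb{Z}$: its vertex set is the disjoint union of the $\mathbb{Z}_{p_i}$, and its simplices are the sets of vertices with at most one vertex in each $\mathbb{Z}_{p_i}$ (the empty simplex, of dimension $-1$, included). Elements of $\mathbb{Z}_{p_0}\times\cdots\times\mathbb{Z}_{p_k}$ are regarded as $k$-simplices of $Y$, and for a set $B$ of such elements let $X(B)=Y^{(k-1)}\cup B$, where $Y^{(k-1)}$ is the $(k-1)$-skeleton of $Y$. Let $\theta:\mathbb{Z}_n\to\mathbb{Z}_{p_0}\times\cdots\times\mathbb{Z}_{p_k}$, $\theta(x)=(x \bmod p_0,\dots,x\bmod p_k)$. Let $\varphi$ be Euler's function, $A_0=\{\varphi(n)+1,\dots,n-1\}$, and let $\Phi_n(z)=\sum_{j=0}^{\varphi(n)}c_jz^j$ be the $n$-th cyclotomic polynomial. For $A\subset\{0,\dots,\varphi(n)\}$ let $K_A=X(\theta(A\cup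 A_0))$, and let $d_A\ge 0$ be the greatest common divisor of the integers $c_j$, $j\in A$, with $d_A=0$ if all of these vanish (in particular if $A=\emptyset$). Then the reduced simplicial cohomology and homology groups with integer coefficients, in degrees $i\in\mathbb{Z}$, are as follows: $$\tilde H^i(K_A;\mathbb{Z})\cong\begin{cases}\mathbb{Z} & i=k-1\text{ and }d_A=0,\\ \mathbb{Z}^{|A|-1}\oplus\mathbb{Z}/d_A\mathbb{Z} & i=k,\\ 0&\text{otherwise,}\end{cases}$$ $$\tilde H_i(K_A;\mathbb{Z})\cong\begin{cases}\mathbb{Z}/d_A\mathbb{Z} & i=k-1,\\ \mathbb{Z}^{|A|}& i=k\text{ and }d_A=0,\\ \mathbb{Z}^{|A|-1}& i=k\text{ and }d_A\neq0,\\ 0&\text{otherwise.}\end{cases}$$ For $A=\emptyset$ the group $\mathbb{Z}^{|A|-1}\oplus\mathbb{Z}/d_A\mathbb{Z}$ is to be read as $0$. -/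

import Mathlib

noncomputable section

namespace BalancedComplex

/-! ### Reduced simplicial homology and cohomology with integer coefficients

The vertices are linearly ordered, so every simplex carries the orientation given by the
increasing order of its vertices. Mathlib's `PreAbstractSimplicialComplex` lists the nonempty
faces; the empty face, the only simplex of dimension `-1`, is added here. Degrees are integers. -/

section Homology

variable {V : Type*} [LinearOrder V]

/-- The simplices of `K` of dimension `i`: the faces with `i + 1` vertices; the empty face is the
only simplex of dimension `-1`. -/
def simplices (K : PreAbstractSimplicialComplex V) (i : ℤ) : Set (Finset V) :=
  {s | (s = ∅ ∨ s ∈ K) ∧ (s.card : ℤ) = i + 1}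

/-- The sign of the facet of `s` opposite to its vertex `v`: `(-1) ^ j` when `v` is the `j`-th
vertex of `s` in increasing order, counted from `0`. -/
def faceSign (s : Finset V) (v : V) : ℤ :=
  (-1) ^ (s.filter (fun w => w < v)).card

/-- The boundary map of the augmented simplicial chain complex, on all finite chains of finite
subsets of `V`: `∂ s = ∑ v ∈ s, ± (s \ {v})`. In particular `∂ {v} = ∅` and `∂ ∅ = 0`. -/
def boundary : (Finset V →₀ ℤ) →ₗ[ℤ] (Finset V →₀ ℤ) :=
  Finsupp.linearCombination ℤ
    (fun s : Finset V => ∑ v ∈ s, faceSign s v • Finsupp.single (s.erase v) (1 : ℤ))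

/-- The group `C_i(K)` of chains: finitely supported functions on the `i`-simplices of `K`. -/
def chains (K : PreAbstractSimplicialComplex V) (i : ℤ) : Submodule ℤ (Finset V →₀ ℤ) :=
  Finsupp.supported ℤ ℤ (simplices K i)

/-- The `i`-cycles of `K`. -/
def cycles (K : PreAbstractSimplicialComplex V) (i : ℤ) : Submodule ℤ (Finset V →₀ ℤ) :=
  chains K i ⊓ LinearMap.ker boundary

/-- The `i`-boundaries of `K`: the image of `C_{i+1}(K)` under the boundary map. -/
def boundaries (K : PreAbstractSimplicialComplex V) (i : ℤ) : Submodule ℤ (Finset V →₀ ℤ) :=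
  (chains K (i + 1)).map boundary

/-- The reduced homology group `H̃_i(K; ℤ)`: cycles modulo boundaries. -/
abbrev ReducedHomology (K : PreAbstractSimplicialComplex V) (i : ℤ) : Type _ :=
  cycles K i ⧸ (boundaries K i).submoduleOf (cycles K i)

/-- The group `C^i(K) = Hom(C_i(K), ℤ)` of cochains: arbitrary integer functions on the
`i`-simplices of `K`, extended by zero to all finite subsets of `V`. -/
def cochains (K : PreAbstractSimplicialComplex V) (i : ℤ) : Submodule ℤ (Finset V → ℤ) where
  carrier := {f | ∀ s, s ∉ simplices K i → f s = 0}
  zero_mem' := fun _ _ => rfl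
  add_mem' := fun hf hg s hs => by simp [hf s hs, hg s hs]
  smul_mem' := fun c f hf s hs => by simp [hf s hs]

open Classical in
/-- The coboundary map of the augmented simplicial cochain complex of `K`:
`(δ f)(s) = f (∂ s) = ∑ v ∈ s, ± f (s \ {v})` for every simplex `s` of `K`. -/
def coboundary (K : PreAbstractSimplicialComplex V) : (Finset V → ℤ) →ₗ[ℤ] (Finset V → ℤ) where
  toFun f s := if s = ∅ ∨ s ∈ K then ∑ v ∈ s, faceSign s v * f (s.erase v) else 0
  map_add' f g := by
    funext s
    by_cases h : s = ∅ ∨ s ∈ K <;> simp [h, mul_add, Finset.sum_add_distrib]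
  map_smul' c f := by
    funext s
    by_cases h : s = ∅ ∨ s ∈ K <;> simp [h, Finset.mul_sum, mul_left_comm]

/-- The `i`-cocycles of `K`. -/
def cocycles (K : PreAbstractSimplicialComplex V) (i : ℤ) : Submodule ℤ (Finset V → ℤ) :=
  cochains K i ⊓ LinearMap.ker (coboundary K)

/-- The `i`-coboundaries of `K`: the image of `C^{i-1}(K)` under the coboundary map. -/
def coboundaries (K : PreAbstractSimplicialComplex V) (i : ℤ) : Submodule ℤ (Finset V → ℤ) :=
  (cochains K (i - 1)).map (coboundary K)

/-- The reduced cohomology group `H̃^i(K; ℤ)`: cocycles modulo coboundaries. -/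
abbrev ReducedCohomology (K : PreAbstractSimplicialComplex V) (i : ℤ) : Type _ :=
  cocycles K i ⧸ (coboundaries K i).submoduleOf (cocycles K i)

end Homology

/-! ### Balanced complexes -/

section Balanced

variable {k : ℕ} (G : Fin (k + 1) → Type*)

/-- The simplicial join `G_0 * ⋯ * G_k` of discrete sets: the vertex set is the disjoint union of
the `G_i`, and a nonempty finite set of vertices is a face when it has at most one vertex in each
`G_i`. -/
def discreteJoin : PreAbstractSimplicialComplex (Σₗ i, G i) where
  faces := {s | s.Nonempty ∧ Set.InjOn (fun v : Σₗ i, G i => (ofLex v).1) (s : Set (Σₗ i, G i))}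
  isRelLowerSet_faces := fun _ hs =>
    ⟨hs.1, fun _ hts ht => ⟨ht, hs.2.mono (Finset.coe_subset.mpr hts)⟩⟩

variable {G}

/-- The oriented `k`-simplex of `G_0 * ⋯ * G_k` with vertices `g_0, …, g_k`. -/
def topSimplex (g : ∀ i, G i) : Finset (Σₗ i, G i) :=
  Finset.univ.map ⟨fun i => toLex ⟨i, g i⟩, fun _ _ h => congrArg (fun v : Σₗ i, G i => (ofLex v).1) h⟩

/-- The balanced complex `X(A) = Y^{(k-1)} ∪ A` where `Y = G_0 * ⋯ * G_k`, for a set `A` of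
elements of `G_0 × ⋯ × G_k`, regarded as `k`-simplices of `Y`. The `(k-1)`-skeleton of `Y` consists
of its faces with at most `k` vertices. -/
def balancedComplex (A : Set (∀ i, G i)) : PreAbstractSimplicialComplex (Σₗ i, G i) where
  faces := {s | s ∈ discreteJoin G ∧ s.card ≤ k} ∪ topSimplex '' A
  isRelLowerSet_faces := by
    have htop : ∀ g : ∀ i, G i, topSimplex g ∈ discreteJoin G := by
      intro g
      refine ⟨⟨toLex ⟨0, g 0⟩, Finset.mem_map.mpr ⟨0, Finset.mem_univ 0, rfl⟩⟩, ?_⟩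
      intro v hv w hw h
      simp only [topSimplex, Finset.coe_map, Finset.coe_univ, Set.image_univ, Set.mem_range] at hv hw
      obtain ⟨i, rfl⟩ := hv
      obtain ⟨j, rfl⟩ := hw
      have hij : i = j := h
      rw [hij]
    rintro s (⟨hs, hc⟩ | ⟨g, hg, rfl⟩)
    · exact ⟨hs.1, fun t hts ht =>
        Or.inl ⟨((discreteJoin G).isRelLowerSet_faces hs).2 hts ht,
          (Finset.card_le_card hts).trans hc⟩⟩
    · refine ⟨(htop g).1, fun t hts ht => ?_⟩
      rcases ((show t ⊆ topSimplex g from hts).ssubset_or_eq) with h | h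
      · refine Or.inl ⟨((discreteJoin G).isRelLowerSet_faces (htop g)).2 hts ht, ?_⟩
        have hlt := Finset.card_lt_card h
        have hcard : (topSimplex g).card = k + 1 := by simp [topSimplex]
        omega
      · exact Or.inr ⟨g, hg, h.symm⟩

end Balanced

/-! ### The complexes `K_A` -/

/-- The order of `ZMod n` by least residues, used only to order the vertices of the complexes. -/
instance zmodLinearOrder : (n : ℕ) → LinearOrder (ZMod n)
  | 0 => inferInstanceAs (LinearOrder ℤ)
  | n + 1 => inferInstanceAs (LinearOrder (Fin (n + 1)))

section Cyclotomic

variable {k : ℕ} (p : Fin (k + 1) → ℕ)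

/-- The map `θ : ℤ/n → ℤ/p_0 × ⋯ × ℤ/p_k`, `x ↦ (x mod p_0, …, x mod p_k)`, with
`n = p_0 ⋯ p_k`. -/
def theta (x : ZMod (∏ i, p i)) : ∀ i, ZMod (p i) :=
  fun i => ZMod.castHom (Finset.dvd_prod_of_mem p (Finset.mem_univ i)) (ZMod (p i)) x

/-- `A_0 = {φ(n) + 1, …, n - 1}`, with `n = p_0 ⋯ p_k`. -/
def baseSet : Finset ℕ :=
  Finset.Ioo (Nat.totient (∏ i, p i)) (∏ i, p i)

/-- The complex `K_A = X(θ(A ∪ A_0))`. -/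
def cyclotomicComplex (A : Finset ℕ) : PreAbstractSimplicialComplex (Σₗ i, ZMod (p i)) :=
  balancedComplex
    (theta p '' ((fun j : ℕ => (j : ZMod (∏ i, p i))) '' ((A ∪ baseSet p : Finset ℕ) : Set ℕ)))

/-- `d_A`: the greatest common divisor of the coefficients `c_j`, `j ∈ A`, of the `n`-th cyclotomic
polynomial, with `n = p_0 ⋯ p_k`; it is `0` when all of them vanish. -/
def coeffGcd (A : Finset ℕ) : ℕ :=
  A.gcd (fun j => ((Polynomial.cyclotomic (∏ i, p i) ℤ).coeff j).natAbs)

end Cyclotomic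

end BalancedComplex

end

open BalancedComplex

noncomputable section

namespace BalancedComplex

open Finset

/-! By the Chinese remainder theorem the top simplices of $Y$ are the residues $j$ modulo $n$, so a
top cochain is a polynomial $\sum_{j<n}\gamma_jX^j$. The crux is `exists_faceSum_eq_iff`: the
cochain is a coboundary of $Y$ exactly when $\Phi_n$ divides this polynomial. In one direction, the
facet opposite to slot $i$ does not see the residue modulo $p_i$. Its contribution is periodic with
period $n/p_i$, hence divisible by a geometric sum that $\Phi_n$ divides (`cyclotomic_dvd_faceSum`).
The converse is a count. The homotopy of `exists_homotopy` shows that a coboundary can take any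
values at the $j$ not prime to $n$. So the $\varphi(n)$ powers $X^j$ with $j$ prime to $n$ span
$\mathbb{Z}[X]/\Phi_n$, which is free of rank $\varphi(n)$, and they are independent
(`eq_zero_of_cyclotomic_dvd`). The same homotopy makes $Y$ acyclic below degree $k$, which leaves
only degrees $k-1$ and $k$ for $K_A$. A multiple of $\Phi_n$ of degree less than $n$ without terms
in $A_0$ is an integer multiple of $\Phi_n$ (`eq_multiple_of_cyclotomic_dvd`). Hence the vector
$c=(c_j)_{j\in A}$ decides everything: $\tilde H^k$ is $\mathbb{Z}^A/\mathbb{Z}c$, $\tilde H^{k-1}$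
consists of the integers $m$ with $mc=0$, and, dually (`boundary_eq_zero_iff`, `exists_topCycle`),
$\tilde H_k$ and $\tilde H_{k-1}$ are the kernel and cokernel of the pairing with $c$. -/

theorem map_mem_of_mem_supported {α M : Type*} [AddCommGroup M] {S : Set α}
    (T : (α →₀ ℤ) →ₗ[ℤ] M) (N : Submodule ℤ M)
    (h : ∀ s ∈ S, T (Finsupp.single s 1) ∈ N) {z : α →₀ ℤ}
    (hz : z ∈ Finsupp.supported ℤ ℤ S) : T z ∈ N := by
  rw [Finsupp.supported_eq_span_single] at hz
  have : Submodule.span ℤ ((fun i => Finsupp.single i (1 : ℤ)) '' S) ≤ N.comap T := by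
    rw [Submodule.span_le]
    rintro _ ⟨s, hs, rfl⟩
    exact h s hs
  exact this hz

/-! ### Orientation signs. -/

section Signs

variable {V : Type*} [LinearOrder V]

theorem faceSign_mul_self (s : Finset V) (v : V) : faceSign s v * faceSign s v = 1 := by
  simp [faceSign, ← mul_pow]

theorem faceSign_erase {s : Finset V} {v w : V} (hv : v ∈ s) :
    faceSign (s.erase v) w = if v < w then -faceSign s w else faceSign s w := by
  unfold faceSign
  rw [filter_erase]
  split_ifs with h
  · have hm : v ∈ s.filter (· < w) := mem_filter.mpr ⟨hv, h⟩
    rw [← card_erase_add_one hm, pow_succ]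
    simp
  · rw [erase_eq_of_notMem (by simp [h])]

theorem faceSign_anticomm {s : Finset V} {v w : V} (hv : v ∈ s) (hw : w ∈ s) (h : v ≠ w) :
    faceSign s v * faceSign (s.erase v) w = -(faceSign s w * faceSign (s.erase w) v) := by
  rw [faceSign_erase hv, faceSign_erase hw]
  rcases lt_or_gt_of_ne h with h | h
  · rw [if_pos h, if_neg h.not_gt]; ring
  · rw [if_pos h, if_neg h.not_gt]; ring

end Signs

/-! ### The boundary map and its transpose. -/

section Boundary

variable {V : Type*} [LinearOrder V]

theorem boundary_single (s : Finset V) :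
    boundary (Finsupp.single s 1) = ∑ v ∈ s, faceSign s v • Finsupp.single (s.erase v) (1 : ℤ) := by
  simp [boundary]

theorem boundary_boundary (z : Finset V →₀ ℤ) : boundary (boundary z) = 0 := by
  suffices h : boundary ∘ₗ boundary = (0 : (Finset V →₀ ℤ) →ₗ[ℤ] (Finset V →₀ ℤ)) from
    LinearMap.congr_fun h z
  refine Finsupp.lhom_ext' fun s => LinearMap.ext_ring ?_
  -- Zero diagonal terms extend the inner sum to all of `s`, so that the two summations can be
  -- exchanged; the double sum then equals its own negative.
  have key : ∀ v ∈ s, faceSign s v • boundary (Finsupp.single (s.erase v) (1 : ℤ)) =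
      ∑ w ∈ s, if v = w then 0 else
        (faceSign s v * faceSign (s.erase v) w) • Finsupp.single ((s.erase v).erase w) (1 : ℤ) := by
    intro v hv
    rw [boundary_single, smul_sum, ← sum_erase_add _ _ hv, if_pos rfl, add_zero]
    refine sum_congr rfl fun w hw => ?_
    rw [if_neg (ne_of_mem_erase hw).symm, smul_smul]
  simp only [LinearMap.comp_apply, Finsupp.lsingle_apply, LinearMap.zero_apply]
  rw [boundary_single, map_sum]
  simp only [map_smul]
  rw [sum_congr rfl key]
  refine self_eq_neg.mp ?_
  nth_rewrite 2 [sum_comm]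
  rw [← sum_neg_distrib]
  refine sum_congr rfl fun v hv => ?_
  rw [← sum_neg_distrib]
  refine sum_congr rfl fun w hw => ?_
  by_cases h : v = w
  · simp [h]
  · rw [if_neg h, if_neg (Ne.symm h), faceSign_anticomm hv hw h, erase_right_comm, neg_smul]

/-- The alternating sum `f (∂ s)`, for all finite sets of vertices `s`. -/
def faceSum (f : Finset V → ℤ) (s : Finset V) : ℤ :=
  ∑ v ∈ s, faceSign s v * f (s.erase v)

theorem linearCombination_boundary (f : Finset V → ℤ) (z : Finset V →₀ ℤ) :
    Finsupp.linearCombination ℤ f (boundary z) = Finsupp.linearCombination ℤ (faceSum f) z := by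
  suffices h : Finsupp.linearCombination ℤ f ∘ₗ boundary =
      Finsupp.linearCombination ℤ (faceSum f) from LinearMap.congr_fun h z
  refine Finsupp.lhom_ext' fun s => LinearMap.ext_ring ?_
  simp [boundary_single, faceSum]

theorem faceSum_eq (f : Finset V → ℤ) (s : Finset V) :
    faceSum f s = Finsupp.linearCombination ℤ f (boundary (Finsupp.single s 1)) := by
  simp [linearCombination_boundary]

theorem faceSum_faceSum (f : Finset V → ℤ) (s : Finset V) : faceSum (faceSum f) s = 0 := by
  rw [faceSum_eq, ← linearCombination_boundary, boundary_boundary, map_zero]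

end Boundary

/-! ### Contracting coloured simplices one colour at a time. -/

section Homotopy

variable {V ι : Type*} [LinearOrder V] [DecidableEq ι] (c : V → ι)

open Classical in
/-- The cone with apex `v` on the simplices without a vertex of the colour of `v`. -/
def cone (v : V) : (Finset V →₀ ℤ) →ₗ[ℤ] (Finset V →₀ ℤ) :=
  Finsupp.linearCombination ℤ fun s : Finset V =>
    if c v ∈ s.image c then 0 else
      faceSign (insert v s) v • Finsupp.single (insert v s) (1 : ℤ)

theorem cone_single_of_mem {v : V} {s : Finset V} (h : c v ∈ s.image c) :
    cone c v (Finsupp.single s 1) = 0 := by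
  simp only [cone, Finsupp.linearCombination_single, one_smul, if_pos h]

theorem cone_single_of_notMem {v : V} {s : Finset V} (h : c v ∉ s.image c) :
    cone c v (Finsupp.single s 1) = faceSign (insert v s) v • Finsupp.single (insert v s) 1 := by
  simp only [cone, Finsupp.linearCombination_single, one_smul, if_neg h]

/-- The chain map homotopic to the identity through the cone with apex `v`. -/
def recolour (v : V) : (Finset V →₀ ℤ) →ₗ[ℤ] (Finset V →₀ ℤ) :=
  LinearMap.id - boundary ∘ₗ cone c v - cone c v ∘ₗ boundary

/-- Here `v` can be joined to `s` and to all its facets, and the usual cone identity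
$\partial(v*s)+v*\partial s=s$ holds. -/
theorem recolour_single_of_notMem {v : V} {s : Finset V} (h : c v ∉ s.image c) :
    recolour c v (Finsupp.single s 1) = 0 := by
  have hv : v ∉ s := fun hv => h (mem_image_of_mem c hv)
  simp only [recolour, LinearMap.sub_apply, LinearMap.id_apply, LinearMap.comp_apply,
    cone_single_of_notMem c h, map_smul, boundary_single, map_sum]
  rw [sum_insert hv, smul_add, smul_smul, faceSign_mul_self, one_smul, erase_insert hv,
    sub_add_eq_sub_sub, sub_self, zero_sub, smul_sum, sub_eq_zero, ← sum_neg_distrib]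
  refine sum_congr rfl fun w hw => ?_
  have hvw : v ≠ w := fun e => hv (e ▸ hw)
  rw [cone_single_of_notMem c (fun h' => h (image_subset_image (erase_subset w s) h')),
    smul_smul, smul_smul, ← neg_smul, ← erase_insert_of_ne hvw]
  congr 1
  have h1 := faceSign_anticomm (mem_insert_self v s) (mem_insert_of_mem hw) hvw
  rw [erase_insert hv] at h1
  have h2 := faceSign_mul_self s w
  have h3 := faceSign_mul_self (insert v s) w
  linear_combination (-faceSign s w * faceSign (insert v s) w) * h1 +
    (faceSign (insert v s) v * faceSign (insert v s) w) * h2 +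
    (faceSign s w * faceSign ((insert v s).erase w) v) * h3

/-- The cone kills `s` and every facet that still contains `u`; only the facet opposite to `u`
survives, and coning it replaces `u` by `v`. -/
theorem recolour_single_of_mem {v : V} {s : Finset V} (hs : Set.InjOn c s) {u : V} (hu : u ∈ s)
    (huv : c u = c v) :
    recolour c v (Finsupp.single s 1) = Finsupp.single s 1 -
      (faceSign s u * faceSign (insert v (s.erase u)) v) •
        Finsupp.single (insert v (s.erase u)) 1 := by
  have h0 : c v ∈ s.image c := huv ▸ mem_image_of_mem c hu
  have h1 : c v ∉ (s.erase u).image c := by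
    rw [mem_image]
    rintro ⟨w, hw, hwv⟩
    exact ne_of_mem_erase hw (hs (mem_of_mem_erase hw) hu (hwv.trans huv.symm))
  simp only [recolour, LinearMap.sub_apply, LinearMap.id_apply, LinearMap.comp_apply,
    cone_single_of_mem c h0, map_zero, sub_zero, boundary_single, map_sum, map_smul]
  rw [sum_eq_single_of_mem u hu, cone_single_of_notMem c h1, smul_smul]
  intro w hw hwu
  rw [cone_single_of_mem c, smul_zero]
  exact huv ▸ mem_image_of_mem c (mem_erase.mpr ⟨hwu.symm, hu⟩)

theorem recolour_single_self {v : V} {s : Finset V} (hs : Set.InjOn c s) (hv : v ∈ s) :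
    recolour c v (Finsupp.single s 1) = 0 := by
  rw [recolour_single_of_mem c hs hv rfl, insert_erase hv, faceSign_mul_self, one_smul, sub_self]

theorem injOn_insert_colour {v : V} {s : Finset V} (hs : Set.InjOn c s) (h : c v ∉ s.image c) :
    Set.InjOn c (insert v s : Finset V) := by
  rw [coe_insert, Set.injOn_insert (fun hv => h (mem_image_of_mem c hv))]
  exact ⟨hs, by simpa using h⟩

/-- The identity on chains of the join is homotopic to a chain map which vanishes on every simplex
that misses a colour of `S` or contains one of the base vertices `b i`, `i ∈ S`. -/
theorem exists_homotopy (b : ι → V) (hb : ∀ i, c (b i) = i) (S : Finset ι) :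
    ∃ H P : (Finset V →₀ ℤ) →ₗ[ℤ] (Finset V →₀ ℤ),
      (∀ z, boundary (H z) + H (boundary z) = z - P z) ∧
      (∀ s : Finset V, Set.InjOn c s → H (Finsupp.single s 1) ∈
        Finsupp.supported ℤ ℤ {t : Finset V | Set.InjOn c t ∧ t.card = s.card + 1}) ∧
      (∀ s : Finset V, Set.InjOn c s → P (Finsupp.single s 1) ∈
        Finsupp.supported ℤ ℤ {t : Finset V | Set.InjOn c t ∧ t.image c = s.image c}) ∧
      (∀ s : Finset V, Set.InjOn c s → (∃ i ∈ S, i ∉ s.image c ∨ b i ∈ s) →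
        P (Finsupp.single s 1) = 0) := by
  induction S using Finset.induction_on with
  | empty =>
    refine ⟨0, LinearMap.id, by simp, by simp, fun s hs => ?_, by simp⟩
    exact Finsupp.single_mem_supported ℤ 1 ⟨hs, rfl⟩
  | insert a S ha ih =>
    obtain ⟨H, P, h1, h2, h3, h4⟩ := ih
    -- A map homotopic to the identity is a chain map: compare the boundary of the homotopy formula
    -- at `z` with the formula at `boundary z`.
    have hP : ∀ z, boundary (P z) = P (boundary z) := by
      intro z
      have e1 := congrArg boundary (h1 z)
      have e2 := h1 (boundary z)
      rw [map_add, boundary_boundary, map_sub, zero_add] at e1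
      rw [boundary_boundary, map_zero, add_zero, e1] at e2
      exact sub_right_injective e2
    have hsub : ∀ s : Finset V, Set.InjOn c s → ∀ u ∈ s, c u = a →
        a ∉ (s.erase u).image c ∧ Set.InjOn c (insert (b a) (s.erase u) : Finset V) ∧
        (insert (b a) (s.erase u)).image c = s.image c := by
      intro s hs u hu hua
      have hn : a ∉ (s.erase u).image c := by
        rw [mem_image]
        rintro ⟨w, hw, hwv⟩
        exact ne_of_mem_erase hw (hs (mem_of_mem_erase hw) hu (hwv.trans hua.symm))
      refine ⟨hn, injOn_insert_colour c (hs.mono (erase_subset u s)) (by rwa [hb]), ?_⟩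
      rw [image_insert, hb, ← hua, ← image_insert, insert_erase hu]
    -- Homotopies compose: with $R$ the recolouring, $1-PR=(1-P)+P(1-R)$, and $P$ commutes with the
    -- boundary.
    refine ⟨H + P ∘ₗ cone c (b a), P ∘ₗ recolour c (b a), fun z => ?_, fun s hs => ?_,
      fun s hs => ?_, fun s hs => ?_⟩
    · have e := h1 z
      simp only [LinearMap.add_apply, LinearMap.comp_apply, map_add, hP, recolour,
        LinearMap.sub_apply, LinearMap.id_apply, map_sub]
      rw [add_add_add_comm, e]
      abel
    · refine Submodule.add_mem _ (h2 s hs) ?_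
      rw [LinearMap.comp_apply]
      by_cases h : c (b a) ∈ s.image c
      · rw [cone_single_of_mem c h, map_zero]
        exact Submodule.zero_mem _
      · rw [cone_single_of_notMem c h, map_smul]
        refine Submodule.smul_mem _ _ (Finsupp.supported_mono ?_
          (h3 _ (injOn_insert_colour c hs h)))
        rintro t ⟨ht, ht'⟩
        refine ⟨ht, ?_⟩
        rw [← card_image_of_injOn ht, ht', card_image_of_injOn (injOn_insert_colour c hs h),
          card_insert_of_notMem fun hv => h (mem_image_of_mem c hv)]
    · rw [LinearMap.comp_apply]
      by_cases h : c (b a) ∈ s.image c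
      · obtain ⟨u, hu, hua⟩ := mem_image.mp h
        obtain ⟨_, hi, he⟩ := hsub s hs u hu (hua.trans (hb a))
        rw [recolour_single_of_mem c hs hu hua, map_sub, map_smul]
        refine Submodule.sub_mem _ (h3 s hs) (Submodule.smul_mem _ _ ?_)
        rw [← he]
        exact h3 _ hi
      · rw [recolour_single_of_notMem c h, map_zero]
        exact Submodule.zero_mem _
    · rintro ⟨i, hiS, hi⟩
      rw [LinearMap.comp_apply]
      by_cases h : c (b a) ∈ s.image c
      · by_cases hia : i = a
        · subst hia
          rw [recolour_single_self c hs (hi.resolve_left fun h' => h' (hb i ▸ h)), map_zero]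
        · have hiS := mem_of_mem_insert_of_ne hiS hia
          obtain ⟨u, hu, hua⟩ := mem_image.mp h
          obtain ⟨_, hin, he⟩ := hsub s hs u hu (hua.trans (hb a))
          -- Exchanging `u` for `b a` keeps the set of colours and every base vertex of another
          -- colour, so the induction hypothesis kills both terms.
          rw [recolour_single_of_mem c hs hu hua, map_sub, map_smul, h4 s hs ⟨i, hiS, hi⟩,
            h4 _ hin ⟨i, hiS, ?_⟩, smul_zero, sub_zero]
          refine hi.imp (fun h' => he ▸ h') fun h' => mem_insert_of_mem (mem_erase.mpr ⟨?_, h'⟩)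
          rintro rfl
          exact hia ((hb i).symm.trans (hua.trans (hb a)))
      · rw [recolour_single_of_notMem c h, map_zero]

end Homotopy

/-! ### Cycles and cocycles in terms of values on simplices. -/

section Cochains

variable {V : Type*} {K : PreAbstractSimplicialComplex V} {i : ℤ}

theorem chains_eq_of_simplices_eq {L : PreAbstractSimplicialComplex V}
    (h : simplices K i = simplices L i) : chains K i = chains L i := by
  rw [chains, h, chains]

theorem cochains_eq_of_simplices_eq {L : PreAbstractSimplicialComplex V}
    (h : simplices K i = simplices L i) :
    cochains K i = cochains L i := by
  ext f
  change (∀ s, s ∉ simplices K i → f s = 0) ↔ ∀ s, s ∉ simplices L i → f s = 0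
  rw [h]

variable [LinearOrder V]

theorem coboundary_apply_of_mem (f : Finset V → ℤ) {s : Finset V} (hs : s ∈ simplices K i) :
    coboundary K f s = faceSum f s :=
  if_pos hs.1

theorem erase_mem_simplices {s : Finset V} (hs : s ∈ simplices K i) {v : V} (hv : v ∈ s) :
    s.erase v ∈ simplices K (i - 1) := by
  refine ⟨?_, ?_⟩
  · rcases (s.erase v).eq_empty_or_nonempty with h | h
    · exact Or.inl h
    · rcases hs.1 with rfl | h'
      · simp at hv
      · exact Or.inr ((K.isRelLowerSet_faces h').2 (erase_subset v s) h)
  · have := card_erase_add_one hv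
    have := hs.2
    omega

theorem boundary_mem_chains {z : Finset V →₀ ℤ} (hz : z ∈ chains K i) :
    boundary z ∈ chains K (i - 1) := by
  refine map_mem_of_mem_supported boundary _ (fun s hs => ?_) hz
  rw [boundary_single]
  refine Submodule.sum_mem _ fun v hv => Submodule.smul_mem _ _ ?_
  exact Finsupp.single_mem_supported ℤ 1 (erase_mem_simplices hs hv)

theorem coboundary_eq_zero_of_notMem {f : Finset V → ℤ} (hf : f ∈ cochains K (i - 1))
    {s : Finset V} (hs : s ∉ simplices K i) : coboundary K f s = 0 := by
  by_cases h : s = ∅ ∨ s ∈ K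
  · refine (if_pos h).trans (sum_eq_zero fun v hv => ?_)
    rw [hf, mul_zero]
    rintro ⟨-, h'⟩
    have := card_erase_add_one hv
    exact hs ⟨h, by omega⟩
  · exact if_neg h

theorem mem_cocycles_iff {f : Finset V → ℤ} :
    f ∈ cocycles K i ↔ f ∈ cochains K i ∧ ∀ s ∈ simplices K (i + 1), faceSum f s = 0 := by
  refine and_congr_right fun hf => ⟨fun h s hs => ?_, fun h => ?_⟩
  · rw [← coboundary_apply_of_mem f hs, LinearMap.mem_ker.mp h, Pi.zero_apply]
  · refine LinearMap.mem_ker.mpr (funext fun s => ?_)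
    by_cases hs : s ∈ simplices K (i + 1)
    · rw [coboundary_apply_of_mem f hs, h s hs, Pi.zero_apply]
    · exact coboundary_eq_zero_of_notMem (by simpa using hf) hs

theorem mem_coboundaries_iff {f : Finset V → ℤ} (hf : f ∈ cochains K i) :
    f ∈ coboundaries K i ↔
      ∃ b ∈ cochains K (i - 1), ∀ s ∈ simplices K i, faceSum b s = f s := by
  constructor
  · rintro ⟨b, hb, rfl⟩
    exact ⟨b, hb, fun s hs => (coboundary_apply_of_mem b hs).symm⟩
  · rintro ⟨b, hb, h⟩
    refine ⟨b, hb, funext fun s => ?_⟩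
    by_cases hs : s ∈ simplices K i
    · rw [coboundary_apply_of_mem b hs, h s hs]
    · rw [coboundary_eq_zero_of_notMem hb hs, hf s hs]

theorem mem_cycles_iff {z : Finset V →₀ ℤ} :
    z ∈ cycles K i ↔ z ∈ chains K i ∧ boundary z = 0 :=
  Iff.rfl

theorem mem_boundaries_iff {z : Finset V →₀ ℤ} :
    z ∈ boundaries K i ↔ ∃ w ∈ chains K (i + 1), boundary w = z :=
  Iff.rfl

theorem reducedHomology_subsingleton (h : ∀ z ∈ cycles K i, z ∈ boundaries K i) :
    Subsingleton (ReducedHomology K i) :=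
  Submodule.Quotient.subsingleton_iff.mpr
    (eq_top_iff.mpr fun z _ => h z z.2)

theorem reducedCohomology_subsingleton (h : ∀ f ∈ cocycles K i, f ∈ coboundaries K i) :
    Subsingleton (ReducedCohomology K i) :=
  Submodule.Quotient.subsingleton_iff.mpr
    (eq_top_iff.mpr fun f _ => h f f.2)

end Cochains

/-! ### The join of discrete sets and its balanced subcomplexes. -/

section Join

variable {k : ℕ} {G : Fin (k + 1) → Type*}

/-- The index of the part of the join that contains a vertex. -/
def slot (v : Σₗ i, G i) : Fin (k + 1) := (ofLex v).1

theorem mem_topSimplex {g : ∀ i, G i} {v : Σₗ i, G i} :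
    v ∈ topSimplex g ↔ ∃ i, toLex ⟨i, g i⟩ = v := by
  refine mem_map.trans ⟨?_, ?_⟩
  · rintro ⟨i, -, h⟩
    exact ⟨i, h⟩
  · rintro ⟨i, h⟩
    exact ⟨i, mem_univ i, h⟩

theorem injOn_slot_topSimplex (g : ∀ i, G i) :
    Set.InjOn slot (topSimplex g : Set (Σₗ i, G i)) := by
  intro v hv w hw h
  obtain ⟨i, rfl⟩ := mem_topSimplex.mp hv
  obtain ⟨j, rfl⟩ := mem_topSimplex.mp hw
  obtain rfl : i = j := h
  rfl

theorem card_topSimplex (g : ∀ i, G i) : (topSimplex g).card = k + 1 := by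
  simp [topSimplex]

theorem topSimplex_injective : Function.Injective (topSimplex (G := G)) := by
  intro g g' h
  funext i
  have hi : toLex ⟨i, g i⟩ ∈ topSimplex g' := h ▸ mem_topSimplex.mpr ⟨i, rfl⟩
  obtain ⟨j, hj⟩ := mem_topSimplex.mp hi
  obtain rfl : j = i := congrArg slot hj
  exact (eq_of_heq (Sigma.mk.inj (toLex.injective hj)).2).symm

theorem mem_simplices_discreteJoin {s : Finset (Σₗ i, G i)} {i : ℤ} :
    s ∈ simplices (discreteJoin G) i ↔
      Set.InjOn slot (s : Set (Σₗ i, G i)) ∧ (s.card : ℤ) = i + 1 := by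
  refine and_congr_left fun _ => ⟨?_, fun h => ?_⟩
  · rintro (rfl | h)
    · simp
    · exact h.2
  · rcases s.eq_empty_or_nonempty with h' | h'
    · exact Or.inl h'
    · exact Or.inr ⟨h', h⟩

theorem simplices_discreteJoin_top :
    simplices (discreteJoin G) k = Set.range (topSimplex (G := G)) := by
  ext s
  rw [mem_simplices_discreteJoin]
  constructor
  · rintro ⟨h, hc⟩
    have himg : s.image slot = univ := by
      refine eq_univ_of_card _ ?_
      rw [card_image_of_injOn h, Fintype.card_fin]
      omega
    have hex : ∀ i, ∃ g : G i, toLex ⟨i, g⟩ ∈ s := by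
      intro i
      obtain ⟨v, hv, rfl⟩ := mem_image.mp (himg ▸ mem_univ i)
      exact ⟨(ofLex v).2, hv⟩
    choose g hg using hex
    refine ⟨g, eq_of_subset_of_card_le (fun v hv => ?_) ?_⟩
    · obtain ⟨i, rfl⟩ := mem_topSimplex.mp hv
      exact hg i
    · rw [card_topSimplex]
      omega
  · rintro ⟨g, rfl⟩
    exact ⟨injOn_slot_topSimplex g, by simp [card_topSimplex]⟩

theorem notMem_image_slot_of_lt {s : Finset (Σₗ i, G i)} {i : ℤ} (hik : i < k)
    (hs : s ∈ simplices (discreteJoin G) i) : ∃ j, j ∉ s.image slot := by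
  by_contra! h
  have h1 : (s.image slot).card = k + 1 := by
    rw [eq_univ_of_forall h, card_univ, Fintype.card_fin]
  have h2 : (s.image slot).card ≤ s.card := card_image_le
  have := hs.2
  omega

theorem simplices_balancedComplex_of_lt (B : Set (∀ i, G i)) {i : ℤ} (h : i < k) :
    simplices (balancedComplex B) i = simplices (discreteJoin G) i := by
  ext s
  refine and_congr_left fun hc => or_congr_right ⟨?_, fun hs => Or.inl ⟨hs, by omega⟩⟩
  rintro (hs | ⟨g, -, rfl⟩)
  · exact hs.1
  · rw [card_topSimplex] at hc
    omega

theorem simplices_balancedComplex_top (B : Set (∀ i, G i)) :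
    simplices (balancedComplex B) k = topSimplex '' B := by
  ext s
  constructor
  · rintro ⟨rfl | hs | hs, hc⟩
    · simp only [card_empty] at hc
      omega
    · have := hs.2
      omega
    · exact hs
  · rintro ⟨g, hg, rfl⟩
    exact ⟨Or.inr (Or.inr ⟨g, hg, rfl⟩), by simp [card_topSimplex]⟩

theorem simplices_balancedComplex_of_gt (B : Set (∀ i, G i)) {i : ℤ} (h : (k : ℤ) < i) :
    simplices (balancedComplex B) i = ∅ := by
  refine Set.eq_empty_of_forall_notMem ?_
  rintro s ⟨rfl | hs | ⟨g, -, rfl⟩, hc⟩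
  · simp only [card_empty] at hc
    omega
  · have := hs.2
    omega
  · rw [card_topSimplex] at hc
    omega

section
variable [∀ i, LinearOrder (G i)]

/-- The lexicographic order compares slots first, so the sign depends on the slot alone and can be
taken out of sums over residues. -/
theorem faceSign_topSimplex (g : ∀ i, G i) (i : Fin (k + 1)) :
    faceSign (topSimplex g) (toLex ⟨i, g i⟩) = (-1) ^ (i : ℕ) := by
  have hlt : ∀ j, (toLex ⟨j, g j⟩ : Σₗ i, G i) < toLex ⟨i, g i⟩ ↔ j < i := by
    refine fun j => ⟨fun h => ?_, fun h => Sigma.Lex.lt_def.mpr (Or.inl h)⟩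
    rcases Sigma.Lex.lt_def.mp h with h | ⟨h', h⟩
    · exact h
    · obtain rfl : j = i := h'
      exact absurd h (lt_irrefl _)
  unfold faceSign
  congr 1
  refine ((congrArg card filter_map).trans (card_map _)).trans ?_
  refine (congrArg card (filter_congr fun j _ => hlt j)).trans ?_
  rw [← Fin.card_Iio i]
  congr 1
  ext j
  simp

/-- The value of a cochain on the facet of the simplex `g` opposite to the vertex `g i`. -/
def facetValue (f : Finset (Σₗ i, G i) → ℤ) (i : Fin (k + 1)) (g : ∀ i, G i) : ℤ :=
  f ((topSimplex g).erase (toLex ⟨i, g i⟩))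

theorem faceSum_topSimplex (f : Finset (Σₗ i, G i) → ℤ) (g : ∀ i, G i) :
    faceSum f (topSimplex g) =
      ∑ i : Fin (k + 1), (-1) ^ (i : ℕ) * facetValue f i g := by
  refine (sum_map _ _ _).trans (sum_congr rfl fun i _ => ?_)
  change faceSign (topSimplex g) (toLex ⟨i, g i⟩) * _ = _
  rw [faceSign_topSimplex]
  rfl

theorem facetValue_congr (f : Finset (Σₗ i, G i) → ℤ) {i : Fin (k + 1)} {g g' : ∀ i, G i}
    (h : ∀ j ≠ i, g j = g' j) : facetValue f i g = facetValue f i g' := by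
  have key : ∀ {g g' : ∀ i, G i}, (∀ j ≠ i, g j = g' j) →
      (topSimplex g).erase (toLex ⟨i, g i⟩) ⊆ (topSimplex g').erase (toLex ⟨i, g' i⟩) := by
    intro g g' h v hv
    obtain ⟨hne, hv⟩ := mem_erase.mp hv
    obtain ⟨j, rfl⟩ := mem_topSimplex.mp hv
    have hji : j ≠ i := by
      rintro rfl
      exact hne rfl
    refine mem_erase.mpr ⟨fun h' => hji (congrArg slot h'), ?_⟩
    exact mem_topSimplex.mpr ⟨j, by rw [h j hji]⟩
  exact congrArg f ((key h).antisymm (key fun j hj => (h j hj).symm))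

/-- Up to boundaries, the identity on chains (and cochains) of a join of discrete sets is a map
which vanishes on all simplices that are not of top dimension or contain a base vertex. -/
theorem exists_projection (e : ∀ i, G i) :
    ∃ P : (Finset (Σₗ i, G i) →₀ ℤ) →ₗ[ℤ] (Finset (Σₗ i, G i) →₀ ℤ),
      (∀ s : Finset (Σₗ i, G i), Set.InjOn slot (s : Set (Σₗ i, G i)) →
        (∃ i, i ∉ s.image slot ∨ toLex ⟨i, e i⟩ ∈ s) → P (Finsupp.single s 1) = 0) ∧
      (∀ (i : ℤ), ∀ z ∈ cycles (discreteJoin G) i,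
        ∃ w ∈ chains (discreteJoin G) (i + 1), boundary w = z - P z) ∧
      (∀ (i : ℤ) (f : Finset (Σₗ i, G i) → ℤ),
        (∀ t ∈ simplices (discreteJoin G) (i + 1), faceSum f t = 0) →
        ∃ b ∈ cochains (discreteJoin G) (i - 1), ∀ s ∈ simplices (discreteJoin G) i,
          faceSum b s = f s - Finsupp.linearCombination ℤ f (P (Finsupp.single s 1))) := by
  classical
  obtain ⟨H, P, h1, h2, -, h4⟩ := exists_homotopy (slot (G := G)) (fun i => toLex ⟨i, e i⟩)
    (fun i => rfl) univ
  have hH : ∀ (i : ℤ), ∀ s ∈ simplices (discreteJoin G) i,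
      H (Finsupp.single s 1) ∈ chains (discreteJoin G) (i + 1) := by
    intro i s hs
    rw [mem_simplices_discreteJoin] at hs
    refine Finsupp.supported_mono (fun t ht => ?_) (h2 s hs.1)
    exact mem_simplices_discreteJoin.mpr ⟨ht.1, by rw [ht.2]; push_cast; rw [hs.2]⟩
  refine ⟨P, fun s hs ⟨i, hi⟩ => h4 s hs ⟨i, mem_univ i, hi⟩, fun i z hz => ?_, fun i f hf => ?_⟩
  · refine ⟨H z, map_mem_of_mem_supported H _ (hH i) hz.1, ?_⟩
    rw [← h1, (mem_cycles_iff.mp hz).2, map_zero, add_zero]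
  -- Transposed homotopy: the primitive is `f` composed with `H`, and the term of `f` on `boundary
  -- (H s)` vanishes by the cocycle condition.
  · refine ⟨fun s => if s ∈ simplices (discreteJoin G) (i - 1) then
      Finsupp.linearCombination ℤ f (H (Finsupp.single s 1)) else 0,
      fun s hs => if_neg hs, fun s hs => ?_⟩
    have e1 : faceSum (fun s => if s ∈ simplices (discreteJoin G) (i - 1) then
        Finsupp.linearCombination ℤ f (H (Finsupp.single s 1)) else 0) s =
        Finsupp.linearCombination ℤ f (H (boundary (Finsupp.single s 1))) := by
      rw [boundary_single]
      simp only [faceSum, map_sum, map_smul, smul_eq_mul]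
      exact sum_congr rfl fun v hv => by rw [if_pos (erase_mem_simplices hs hv)]
    have e2 : Finsupp.linearCombination ℤ f (boundary (H (Finsupp.single s 1))) = 0 := by
      rw [linearCombination_boundary]
      refine (Submodule.mem_bot ℤ).mp (map_mem_of_mem_supported _ ⊥ (fun t ht => ?_) (hH i s hs))
      simp [hf t ht]
    have e3 := congrArg (Finsupp.linearCombination ℤ f) (h1 (Finsupp.single s 1))
    rw [map_add, e2, zero_add, map_sub] at e3
    rw [e1, e3]
    simp

variable [∀ i, Nonempty (G i)]

/-- A simplex of dimension below `k` misses a slot, so the projection homotopic to the identity is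
zero in these degrees. -/
theorem discreteJoin_exact_chains {i : ℤ} (hik : i < k) {z : Finset (Σₗ i, G i) →₀ ℤ}
    (hz : z ∈ cycles (discreteJoin G) i) :
    ∃ w ∈ chains (discreteJoin G) (i + 1), boundary w = z := by
  obtain ⟨P, hP, h, -⟩ := exists_projection (G := G) fun i => Classical.arbitrary _
  obtain ⟨w, hw, e⟩ := h i z hz
  refine ⟨w, hw, e.trans (sub_eq_self.mpr ?_)⟩
  refine (Submodule.mem_bot ℤ).mp (map_mem_of_mem_supported P ⊥ (fun s hs => ?_) hz.1)
  exact hP s (mem_simplices_discreteJoin.mp hs).1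
    ((notMem_image_slot_of_lt hik hs).imp fun _ => Or.inl)

theorem discreteJoin_exact_cochains {i : ℤ} (hik : i < k) {f : Finset (Σₗ i, G i) → ℤ}
    (hf : ∀ t ∈ simplices (discreteJoin G) (i + 1), faceSum f t = 0) :
    ∃ b ∈ cochains (discreteJoin G) (i - 1), ∀ s ∈ simplices (discreteJoin G) i,
      faceSum b s = f s := by
  obtain ⟨P, hP, -, h⟩ := exists_projection (G := G) fun i => Classical.arbitrary _
  obtain ⟨b, hb, e⟩ := h i f hf
  refine ⟨b, hb, fun s hs => ?_⟩
  rw [e s hs, hP s (mem_simplices_discreteJoin.mp hs).1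
    ((notMem_image_slot_of_lt hik hs).imp fun _ => Or.inl), map_zero, sub_zero]

variable (B : Set (∀ i, G i))

/-- Up to dimension $k-1$ the simplices are those of the join, which is acyclic there; above `k`
there are none. -/
theorem balancedComplex_reducedHomology_subsingleton {i : ℤ} (h1 : i ≠ k) (h2 : i ≠ (k : ℤ) - 1) :
    Subsingleton (ReducedHomology (balancedComplex B) i) := by
  refine reducedHomology_subsingleton fun z hz => ?_
  rcases lt_or_ge (k : ℤ) i with h | h
  · have hz := (mem_cycles_iff.mp hz).1
    rw [chains, simplices_balancedComplex_of_gt B h, Finsupp.supported_empty] at hz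
    rw [(Submodule.mem_bot ℤ).mp hz]
    exact Submodule.zero_mem _
  · have e1 := chains_eq_of_simplices_eq (simplices_balancedComplex_of_lt B (i := i) (by omega))
    have e2 := chains_eq_of_simplices_eq (simplices_balancedComplex_of_lt B (i := i + 1) (by omega))
    rw [mem_boundaries_iff, e2]
    rw [mem_cycles_iff, e1] at hz
    exact discreteJoin_exact_chains (by omega) hz

theorem balancedComplex_reducedCohomology_subsingleton {i : ℤ} (h1 : i ≠ k)
    (h2 : i ≠ (k : ℤ) - 1) : Subsingleton (ReducedCohomology (balancedComplex B) i) := by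
  refine reducedCohomology_subsingleton fun f hf => ?_
  rw [mem_cocycles_iff] at hf
  rw [mem_coboundaries_iff hf.1]
  rcases lt_or_ge (k : ℤ) i with h | h
  · rw [simplices_balancedComplex_of_gt B h]
    exact ⟨0, Submodule.zero_mem _, fun s hs => hs.elim⟩
  · rw [simplices_balancedComplex_of_lt B (i := i + 1) (by omega)] at hf
    rw [simplices_balancedComplex_of_lt B (i := i) (by omega), cochains_eq_of_simplices_eq
      (simplices_balancedComplex_of_lt B (i := i - 1) (by omega))]
    exact discreteJoin_exact_cochains (by omega) hf.2

end

end Join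

/-! ### Integer sequences as polynomials modulo $\Phi_n$. -/

section Polynomials

open Polynomial

/-- The polynomial of degree less than `n` with coefficients `γ 0, …, γ (n - 1)`. -/
def coeffPoly (n : ℕ) (γ : ℕ → ℤ) : ℤ[X] := ∑ j ∈ range n, C (γ j) * X ^ j

theorem coeff_coeffPoly (n : ℕ) (γ : ℕ → ℤ) (j : ℕ) :
    (coeffPoly n γ).coeff j = if j < n then γ j else 0 := by
  simp [coeffPoly]

theorem coeffPoly_sub (n : ℕ) (γ γ' : ℕ → ℤ) :
    coeffPoly n (γ - γ') = coeffPoly n γ - coeffPoly n γ' := by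
  simp [coeffPoly, sub_mul]

theorem coeffPoly_sum {ι : Type*} (s : Finset ι) (n : ℕ) (a : ι → ℤ) (γ : ι → ℕ → ℤ) :
    coeffPoly n (fun j => ∑ i ∈ s, a i * γ i j) = ∑ i ∈ s, C (a i) * coeffPoly n (γ i) := by
  ext j
  simp only [finsetSum_coeff, coeff_C_mul, coeff_coeffPoly]
  split_ifs <;> simp

theorem coeffPoly_coeff {n : ℕ} {f : ℤ[X]} (hf : ∀ j, n ≤ j → f.coeff j = 0) :
    coeffPoly n f.coeff = f := by
  ext j
  rw [coeff_coeffPoly]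
  split_ifs with h
  · rfl
  · exact (hf j (not_lt.mp h)).symm

theorem coeffPoly_mul_of_periodic {q : ℕ} {γ : ℕ → ℤ} (hγ : Function.Periodic γ q) (m : ℕ) :
    coeffPoly (q * m) γ = coeffPoly q γ * ∑ t ∈ range m, (X ^ q) ^ t := by
  induction m with
  | zero => simp [coeffPoly]
  | succ m ih =>
    rw [Nat.mul_succ, sum_range_succ, mul_add (coeffPoly q γ), ← ih, coeffPoly, sum_range_add,
      ← coeffPoly, add_right_inj, coeffPoly, sum_mul]
    refine sum_congr rfl fun j _ => ?_
    have hper : γ (q * m + j) = γ j := by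
      rw [add_comm, mul_comm]
      exact hγ.nat_mul m j
    rw [hper, pow_add, ← pow_mul]
    ring

/-- The sum is $(X^{qm}-1)/(X^q-1)$, and $q$ is a proper divisor of $qm$, so $\Phi_{qm}$ survives in
the quotient. -/
theorem cyclotomic_dvd_geom_sum {q m : ℕ} (hq : 0 < q) (hm : 1 < m) :
    cyclotomic (q * m) ℤ ∣ ∑ t ∈ range m, (X ^ q) ^ t := by
  have h : q ∈ (q * m).properDivisors :=
    Nat.mem_properDivisors.mpr ⟨dvd_mul_right q m, lt_mul_of_one_lt_right hq hm⟩
  have h1 := X_pow_sub_one_mul_cyclotomic_dvd_X_pow_sub_one_of_dvd ℤ h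
  rw [pow_mul, ← mul_geom_sum (X ^ q) m] at h1
  refine (mul_dvd_mul_iff_left ?_).mp h1
  simpa using X_pow_sub_C_ne_zero hq (1 : ℤ)

/-- If, modulo the `n`-th cyclotomic polynomial, every polynomial is a combination of the powers
`X ^ j` with `j < n` prime to `n`, then these powers are independent. -/
theorem eq_zero_of_cyclotomic_dvd {n : ℕ}
    (hspan : ∀ γ : ℕ → ℤ, ∃ γ' : ℕ → ℤ, (∀ j < n, ¬ n.Coprime j → γ' j = 0) ∧
      cyclotomic n ℤ ∣ coeffPoly n γ - coeffPoly n γ')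
    {γ : ℕ → ℤ} (h0 : ∀ j < n, ¬ n.Coprime j → γ j = 0)
    (hγ : cyclotomic n ℤ ∣ coeffPoly n γ) : ∀ j < n, γ j = 0 := by
  have hmonic := cyclotomic.monic n ℤ
  let U := {j // j ∈ (range n).filter n.Coprime}
  let L : ({j // j ∈ (range n).filter n.Coprime} → ℤ) →ₗ[ℤ] AdjoinRoot (cyclotomic n ℤ) :=
    Fintype.linearCombination ℤ fun u => AdjoinRoot.mk (cyclotomic n ℤ) (X ^ (u : ℕ))
  have hL : ∀ γ : ℕ → ℤ, (∀ j < n, ¬ n.Coprime j → γ j = 0) →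
      L (fun u => γ u) = AdjoinRoot.mk (cyclotomic n ℤ) (coeffPoly n γ) := by
    intro γ h0
    have hfilter : coeffPoly n γ = ∑ j ∈ (range n).filter n.Coprime, C (γ j) * X ^ j := by
      refine (sum_filter_of_ne fun j hj hne => ?_).symm
      by_contra hc
      exact hne (by rw [h0 j (mem_range.mp hj) hc]; simp)
    rw [Fintype.linearCombination_apply, hfilter, map_sum,
      ← sum_coe_sort ((range n).filter n.Coprime)]
    refine sum_congr rfl fun u _ => ?_
    rw [map_mul, zsmul_eq_mul]
    simp
  -- A class is represented by its remainder, of degree below $\varphi(n)\le n$, to which `hspan`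
  -- applies.
  have hsurj : Function.Surjective L := by
    intro x
    obtain ⟨f, rfl⟩ := AdjoinRoot.mk_surjective x
    obtain ⟨γ', h0', hd⟩ := hspan (f %ₘ cyclotomic n ℤ).coeff
    refine ⟨fun u => γ' u, ?_⟩
    rw [hL γ' h0', AdjoinRoot.mk_eq_mk]
    have hdeg : ∀ j, n ≤ j → (f %ₘ cyclotomic n ℤ).coeff j = 0 := by
      intro j hj
      refine coeff_eq_zero_of_degree_lt ((degree_modByMonic_lt f hmonic).trans_le ?_)
      rw [degree_cyclotomic]
      exact_mod_cast (Nat.totient_le n).trans hj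
    rw [coeffPoly_coeff hdeg] at hd
    have hsub := modByMonic_add_div f (cyclotomic n ℤ)
    nth_rewrite 1 [← hsub]
    rw [← dvd_neg, neg_sub, add_sub_right_comm]
    exact dvd_add hd (dvd_mul_right _ _)
  have hcard : Module.finrank ℤ (U → ℤ) = Module.finrank ℤ (AdjoinRoot (cyclotomic n ℤ)) := by
    rw [Module.finrank_fintype_fun_eq_card, (AdjoinRoot.powerBasis' hmonic).finrank,
      AdjoinRoot.powerBasis'_dim, natDegree_cyclotomic, Fintype.card_coe]
    rfl
  have := hmonic.free_adjoinRoot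
  have := hmonic.finite_adjoinRoot
  let e := LinearEquiv.ofFinrankEq _ _ hcard.symm
  -- Both sides are free of rank $\varphi(n)$, and a surjective endomorphism of a finitely generated
  -- module is injective.
  have hinj : Function.Injective (e.toLinearMap ∘ₗ L) :=
    OrzechProperty.injective_of_surjective_endomorphism _ (e.surjective.comp hsurj)
  have hz : (fun u : U => γ u) = 0 := by
    refine hinj ?_
    rw [LinearMap.comp_apply, hL γ h0, AdjoinRoot.mk_eq_zero.mpr hγ]
    simp
  intro j hj
  by_cases hc : n.Coprime j
  · exact congrFun hz ⟨j, mem_filter.mpr ⟨mem_range.mpr hj, hc⟩⟩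
  · exact h0 j hj hc

end Polynomials

/-! ### Coboundaries of the join as cyclotomic relations. -/

section Residues

variable {k : ℕ} (p : Fin (k + 1) → ℕ)

theorem theta_natCast (j : ℕ) (i : Fin (k + 1)) :
    theta p (j : ZMod (∏ i, p i)) i = (j : ZMod (p i)) :=
  map_natCast _ j

/-- The top simplex of the join given by the residues of `j` modulo the `p i`. -/
def residueSimplex (j : ℕ) : Finset (Σₗ i, ZMod (p i)) :=
  topSimplex (theta p (j : ZMod (∏ i, p i)))

variable {p}

theorem residueSimplex_mem (j : ℕ) :
    residueSimplex p j ∈ simplices (discreteJoin fun i => ZMod (p i)) k :=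
  simplices_discreteJoin_top (G := fun i => ZMod (p i)) ▸ ⟨_, rfl⟩

theorem simplices_discreteJoin_of_gt {G : Fin (k + 1) → Type*} {i : ℤ} (h : (k : ℤ) < i) :
    simplices (discreteJoin G) i = ∅ := by
  refine Set.eq_empty_of_forall_notMem fun s hs => ?_
  rw [mem_simplices_discreteJoin] at hs
  have h1 : (s.image slot).card ≤ k + 1 := (card_le_univ _).trans_eq (Fintype.card_fin _)
  rw [card_image_of_injOn hs.1] at h1
  omega

/-- The value on the facet opposite to slot `i` has period $q=n/p_i$ in `j`; its polynomial is one
period times $\sum_{t<p_i}X^{qt}$, a multiple of $\Phi_n$. -/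
theorem cyclotomic_dvd_faceSum (hp : ∀ i, (p i).Prime)
    (b : Finset (Σₗ i, ZMod (p i)) → ℤ) :
    Polynomial.cyclotomic (∏ i, p i) ℤ ∣
      coeffPoly (∏ i, p i) fun j => faceSum b (residueSimplex p j) := by
  simp only [residueSimplex, faceSum_topSimplex]
  rw [coeffPoly_sum]
  refine dvd_sum fun i _ => Dvd.dvd.mul_left ?_ _
  have hq : ∏ i, p i = (∏ j ∈ univ.erase i, p j) * p i := (prod_erase_mul _ _ (mem_univ i)).symm
  have hpos : 0 < ∏ j ∈ univ.erase i, p j := prod_pos fun j _ => (hp j).pos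
  set q := ∏ j ∈ univ.erase i, p j with hqdef
  have hper : Function.Periodic
      (fun j : ℕ => facetValue b i (theta p (j : ZMod (∏ i, p i)))) q := by
    refine fun j => facetValue_congr b fun l hl => ?_
    rw [theta_natCast, theta_natCast, Nat.cast_add, add_eq_left, ZMod.natCast_eq_zero_iff]
    exact dvd_prod_of_mem p (mem_erase.mpr ⟨hl, mem_univ l⟩)
  have hmul := coeffPoly_mul_of_periodic hper (p i)
  rw [← hq] at hmul
  rw [hmul]
  refine Dvd.dvd.mul_left ?_ _
  rw [hq]
  exact cyclotomic_dvd_geom_sum hpos (hp i).one_lt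

theorem theta_bijective (hp : ∀ i, (p i).Prime) (hinj : Function.Injective p) :
    Function.Bijective (theta p) := by
  have h := (ZMod.prodEquivPi p fun i j hij =>
    (Nat.coprime_primes (hp i) (hp j)).mpr (hinj.ne hij)).bijective
  convert h using 1
  funext x i
  obtain ⟨j, rfl⟩ := ZMod.intCast_surjective x
  rw [theta, map_intCast, map_intCast]
  rfl

theorem residueSimplex_injOn (hp : ∀ i, (p i).Prime) (hinj : Function.Injective p) {j j' : ℕ}
    (hj : j < ∏ i, p i) (hj' : j' < ∏ i, p i) (h : residueSimplex p j = residueSimplex p j') :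
    j = j' := by
  have h1 := (theta_bijective hp hinj).1 (topSimplex_injective h)
  rw [ZMod.natCast_eq_natCast_iff] at h1
  exact Nat.ModEq.eq_of_lt_of_lt h1 hj hj'

theorem exists_residueSimplex_eq (hp : ∀ i, (p i).Prime) (hinj : Function.Injective p)
    {s : Finset (Σₗ i, ZMod (p i))} (hs : s ∈ simplices (discreteJoin fun i => ZMod (p i)) k) :
    ∃ j < ∏ i, p i, residueSimplex p j = s := by
  rw [simplices_discreteJoin_top] at hs
  obtain ⟨g, rfl⟩ := hs
  obtain ⟨x, rfl⟩ := (theta_bijective hp hinj).2 g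
  have : NeZero (∏ i, p i) := ⟨prod_ne_zero_iff.mpr fun i _ => (hp i).ne_zero⟩
  refine ⟨x.val, x.val_lt, ?_⟩
  rw [residueSimplex, ZMod.natCast_rightInverse x]

/-- The cochain with values `γ 0, …, γ (n - 1)` on the top simplices given by `0, …, n - 1`. -/
def residueCochain (p : Fin (k + 1) → ℕ) (γ : ℕ → ℤ) (s : Finset (Σₗ i, ZMod (p i))) : ℤ :=
  ∑ j ∈ range (∏ i, p i), if residueSimplex p j = s then γ j else 0

theorem residueCochain_apply (hp : ∀ i, (p i).Prime) (hinj : Function.Injective p) (γ : ℕ → ℤ)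
    {j : ℕ} (hj : j < ∏ i, p i) : residueCochain p γ (residueSimplex p j) = γ j := by
  rw [residueCochain, sum_eq_single_of_mem j (mem_range.mpr hj), if_pos rfl]
  intro j' hj' hne
  exact if_neg fun h => hne (residueSimplex_injOn hp hinj (mem_range.mp hj') hj h)

/-- With base vertices $0$, the simplices containing a base vertex are those of the `j` divisible by
some $p_i$. The projection kills them, so there a top cochain, which is automatically a cocycle of
the join, equals a coboundary. -/
theorem exists_faceSum_eq_of_not_coprime (hp : ∀ i, (p i).Prime) (hinj : Function.Injective p)
    (γ : ℕ → ℤ) : ∃ b ∈ cochains (discreteJoin fun i => ZMod (p i)) ((k : ℤ) - 1),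
      ∀ j < ∏ i, p i, ¬ (∏ i, p i).Coprime j → faceSum b (residueSimplex p j) = γ j := by
  obtain ⟨P, hP, -, h⟩ := exists_projection (G := fun i => ZMod (p i)) fun _ => 0
  obtain ⟨b, hb, e⟩ := h k (residueCochain p γ) (by simp [simplices_discreteJoin_of_gt])
  refine ⟨b, hb, fun j hj hc => ?_⟩
  have hex : ∃ i, p i ∣ j := by
    by_contra! hndvd
    exact hc (Nat.Coprime.prod_left fun i _ => ((hp i).coprime_iff_not_dvd).mpr (hndvd i))
  obtain ⟨i, hi⟩ := hex
  rw [e _ (residueSimplex_mem j), residueCochain_apply hp hinj γ hj,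
    hP (residueSimplex p j) (injOn_slot_topSimplex _), map_zero, sub_zero]
  refine ⟨i, Or.inr (mem_topSimplex.mpr ⟨i, ?_⟩)⟩
  rw [theta_natCast, (ZMod.natCast_eq_zero_iff j (p i)).mpr hi]

/-- The coboundaries of top degree of the join of the `ℤ / p i`, regarded as functions on `ℤ / n`,
are the relations between the powers of a primitive `n`-th root of unity. -/
theorem exists_faceSum_eq_iff (hp : ∀ i, (p i).Prime) (hinj : Function.Injective p) (γ : ℕ → ℤ) :
    (∃ b ∈ cochains (discreteJoin fun i => ZMod (p i)) ((k : ℤ) - 1),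
      ∀ j < ∏ i, p i, faceSum b (residueSimplex p j) = γ j) ↔
    Polynomial.cyclotomic (∏ i, p i) ℤ ∣ coeffPoly (∏ i, p i) γ := by
  constructor
  · rintro ⟨b, -, h⟩
    convert cyclotomic_dvd_faceSum hp b using 1
    exact sum_congr rfl fun j hj => by simp only [h j (mem_range.mp hj)]
  · intro hγ
    obtain ⟨b, hb, h⟩ := exists_faceSum_eq_of_not_coprime hp hinj γ
    refine ⟨b, hb, fun j hj => ?_⟩
    -- After subtracting the coboundary, the relation is supported on `j` prime to $n$ and must
    -- vanish. The spanning hypothesis follows from the same freedom at the other `j`.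
    have h0 := eq_zero_of_cyclotomic_dvd (fun γ => ?_)
      (γ := γ - fun j => faceSum b (residueSimplex p j))
      (fun j hj hc => sub_eq_zero.mpr (h j hj hc).symm)
      (by rw [coeffPoly_sub]; exact dvd_sub hγ (cyclotomic_dvd_faceSum hp b)) j hj
    · exact (sub_eq_zero.mp h0).symm
    · obtain ⟨b, -, h⟩ := exists_faceSum_eq_of_not_coprime hp hinj γ
      refine ⟨γ - fun j => faceSum b (residueSimplex p j),
        fun j hj hc => sub_eq_zero.mpr (h j hj hc).symm, ?_⟩
      rw [coeffPoly_sub, sub_sub_cancel]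
      exact cyclotomic_dvd_faceSum hp b

end Residues

/-! ### The quotient and the orthogonal complement of an integer vector. -/

section IntegerVectors

theorem natCast_gcd_natAbs {α : Type*} (s : Finset α) (c : α → ℤ) :
    ((s.gcd fun j => (c j).natAbs : ℕ) : ℤ) = s.gcd c := by
  classical
  induction s using Finset.induction_on with
  | empty => simp
  | insert a s ha ih =>
    rw [gcd_insert, gcd_insert, ← ih, ← Int.coe_gcd]
    rfl

/-- A nonempty integer vector is its content times a primitive vector. -/
theorem exists_eq_gcd_mul_primitive {α : Type*} {s : Finset α} (hs : s.Nonempty) (c : α → ℤ) :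
    ∃ u w : s → ℤ, (∀ i : s, c i = (s.gcd fun j => (c j).natAbs : ℕ) * u i) ∧
      ∑ i, u i * w i = 1 := by
  -- This also covers `c` vanishing on `s`: the content is then $0$ and the primitive vector is
  -- still available, so $d=0$ needs no separate case.
  obtain ⟨g, hg, h1⟩ := extract_gcd c hs
  obtain ⟨w, hw⟩ := gcd_eq_sum_mul s g
  refine ⟨fun i => g i, fun i => w i, fun i => ?_, ?_⟩
  · rw [natCast_gcd_natAbs]
    exact hg i i.2
  · rw [sum_coe_sort s (fun i => g i * w i), ← hw, h1]

/-- The kernel is free as a submodule of a free module over a principal ideal domain; additivity of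
rank gives its rank. -/
theorem nonempty_ker_equiv {ι : Type*} [Fintype ι] (w : (ι → ℤ) →ₗ[ℤ] ℤ)
    (hw : Function.Surjective w) :
    Nonempty (LinearMap.ker w ≃ₗ[ℤ] (Fin (Fintype.card ι - 1) → ℤ)) := by
  have h1 := Submodule.finrank_quotient_add_finrank (LinearMap.ker w)
  rw [(w.quotKerEquivOfSurjective hw).finrank_eq, Module.finrank_self,
    Module.finrank_fintype_fun_eq_card] at h1
  exact ⟨LinearEquiv.ofFinrankEq _ _ (by rw [Module.finrank_fin_fun]; omega)⟩

/-- The quotient of `ℤ ^ s` by a vector `c` of content `d` is `ℤ ^ (|s| - 1) × ℤ / d`. -/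
theorem exists_surjective_ker_eq_multiples {α : Type*} {s : Finset α} (hs : s.Nonempty)
    (c : α → ℤ) :
    ∃ F : (s → ℤ) →ₗ[ℤ] (Fin (s.card - 1) → ℤ) × ZMod (s.gcd fun j => (c j).natAbs),
      Function.Surjective F ∧ ∀ a, F a = 0 ↔ ∃ m : ℤ, ∀ i : s, a i = m * c i := by
  obtain ⟨u, w, hc, huw⟩ := exists_eq_gcd_mul_primitive hs c
  set d := s.gcd fun j => (c j).natAbs
  let W : (s → ℤ) →ₗ[ℤ] ℤ := Fintype.linearCombination ℤ w
  have hWu : W u = 1 := by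
    rw [Fintype.linearCombination_apply]
    simpa using huw
  obtain ⟨e⟩ := nonempty_ker_equiv W fun t => ⟨t • u, by rw [map_smul, hWu, smul_eq_mul, mul_one]⟩
  rw [Fintype.card_coe] at e
  -- Since $W(u)=1$, the lattice splits as $\ker W\oplus\mathbb{Z}u$ and `Q` is the first
  -- projection; $c=du$ lies in the second summand with coordinate $d$.
  let Q : (s → ℤ) →ₗ[ℤ] LinearMap.ker W :=
    (LinearMap.id - W.smulRight u).codRestrict _ fun a => by
      rw [LinearMap.mem_ker, LinearMap.sub_apply, LinearMap.id_apply, LinearMap.smulRight_apply,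
        map_sub, map_smul, hWu, smul_eq_mul, mul_one, sub_self]
  have hQ : ∀ a, ((Q a : LinearMap.ker W) : s → ℤ) = a - W a • u := fun a => rfl
  refine ⟨(e.toLinearMap ∘ₗ Q).prod ((Int.castAddHom (ZMod d)).toIntLinearMap ∘ₗ W), ?_, ?_⟩
  · rintro ⟨x, t⟩
    obtain ⟨t, rfl⟩ := ZMod.intCast_surjective t
    obtain ⟨y, rfl⟩ := e.surjective x
    have hy : W (y + t • u) = t := by
      rw [map_add, LinearMap.mem_ker.mp y.2, map_smul, hWu]
      simp
    refine ⟨y + t • u, Prod.ext ?_ ?_⟩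
    · refine congrArg e (Subtype.ext ?_)
      rw [hQ, hy, add_sub_cancel_right]
    · exact congrArg (Int.cast (R := ZMod d)) hy
  · intro a
    have h1 : (e.toLinearMap ∘ₗ Q).prod ((Int.castAddHom (ZMod d)).toIntLinearMap ∘ₗ W) a = 0 ↔
        a = W a • u ∧ (d : ℤ) ∣ W a := by
      rw [← ZMod.intCast_zmod_eq_zero_iff_dvd, ← sub_eq_zero (a := a), ← hQ,
        ZeroMemClass.coe_eq_zero, ← e.map_eq_zero_iff]
      exact Prod.ext_iff
    rw [h1]
    constructor
    · rintro ⟨ha, m, hm⟩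
      refine ⟨m, fun i => ?_⟩
      rw [ha, hm, hc i, Pi.smul_apply, smul_eq_mul]
      ring
    · rintro ⟨m, hm⟩
      have ha : a = (m * d) • u := by
        funext i
        rw [hm, hc i, Pi.smul_apply, smul_eq_mul]
        ring
      have hW : W a = m * d := by rw [ha, map_smul, hWu, smul_eq_mul, mul_one]
      exact ⟨by rw [hW]; exact ha, hW ▸ dvd_mul_left _ _⟩

/-- Dividing by the nonzero content leaves the kernel unchanged and makes the form surjective. -/
theorem nonempty_orthogonal_equiv {α : Type*} (s : Finset α) (c : α → ℤ)
    (hd : (s.gcd fun j => (c j).natAbs) ≠ 0) :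
    Nonempty (LinearMap.ker (Fintype.linearCombination ℤ fun i : s => c i) ≃ₗ[ℤ]
      (Fin (s.card - 1) → ℤ)) := by
  have hs : s.Nonempty := by
    rw [nonempty_iff_ne_empty]
    rintro rfl
    exact hd rfl
  obtain ⟨u, w, hc, huw⟩ := exists_eq_gcd_mul_primitive hs c
  have hker : LinearMap.ker (Fintype.linearCombination ℤ fun i : s => c i) =
      LinearMap.ker (Fintype.linearCombination ℤ u) := by
    ext a
    rw [LinearMap.mem_ker, LinearMap.mem_ker, Fintype.linearCombination_apply,
      Fintype.linearCombination_apply]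
    have hsum : ∑ i, a i • c i = (s.gcd fun j => (c j).natAbs : ℕ) * ∑ i, a i • u i := by
      rw [mul_sum]
      refine sum_congr rfl fun i _ => ?_
      rw [hc, smul_eq_mul, smul_eq_mul, mul_left_comm]
    rw [hsum, mul_eq_zero, or_iff_right (by exact_mod_cast hd)]
  obtain ⟨e⟩ := nonempty_ker_equiv (Fintype.linearCombination ℤ u) fun t => ⟨t • w, by
    rw [map_smul, Fintype.linearCombination_apply]
    simp only [smul_eq_mul, mul_comm (w _), huw, mul_one]⟩
  rw [Fintype.card_coe] at e
  exact ⟨(LinearEquiv.ofEq _ _ hker).trans e⟩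

theorem nonempty_addEquiv_of_ker_eq {M P Q : Type*} [AddCommGroup M] [AddCommGroup P]
    [AddCommGroup Q] (f : M →ₗ[ℤ] P) (g : M →ₗ[ℤ] Q) (hf : Function.Surjective f)
    (hg : Function.Surjective g) (h : ∀ x, f x = 0 ↔ g x = 0) : Nonempty (P ≃+ Q) := by
  have hker : LinearMap.ker f = LinearMap.ker g := Submodule.ext h
  exact ⟨((f.quotKerEquivOfSurjective hf).symm.trans ((Submodule.quotEquivOfEq _ _ hker).trans
    (g.quotKerEquivOfSurjective hg))).toAddEquiv⟩

end IntegerVectors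

/-! ### Homology groups from surjections with the right kernel. -/

section Quotients

variable {V : Type*} [LinearOrder V] {K : PreAbstractSimplicialComplex V} {i : ℤ}
  {Q : Type*} [AddCommGroup Q]

theorem nonempty_reducedHomology_equiv (g : cycles K i →ₗ[ℤ] Q) (hg : Function.Surjective g)
    (h : ∀ z, g z = 0 ↔ (z : Finset V →₀ ℤ) ∈ boundaries K i) :
    Nonempty (ReducedHomology K i ≃+ Q) :=
  nonempty_addEquiv_of_ker_eq (Submodule.mkQ _) g (Submodule.mkQ_surjective _) hg fun z => by
    rw [h, Submodule.mkQ_apply, Submodule.Quotient.mk_eq_zero]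
    rfl

theorem nonempty_reducedCohomology_equiv (g : cocycles K i →ₗ[ℤ] Q) (hg : Function.Surjective g)
    (h : ∀ f, g f = 0 ↔ (f : Finset V → ℤ) ∈ coboundaries K i) :
    Nonempty (ReducedCohomology K i ≃+ Q) :=
  nonempty_addEquiv_of_ker_eq (Submodule.mkQ _) g (Submodule.mkQ_surjective _) hg fun z => by
    rw [h, Submodule.mkQ_apply, Submodule.Quotient.mk_eq_zero]
    rfl

end Quotients

/-! ### Division by $\Phi_n$ and linear forms on the quotient. -/

section CyclotomicRelations

open Polynomial

variable {n : ℕ}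

theorem coeff_cyclotomic_totient : (cyclotomic n ℤ).coeff n.totient = 1 := by
  rw [← natDegree_cyclotomic n ℤ]
  exact cyclotomic.monic n ℤ

theorem coeff_cyclotomic_eq_zero {j : ℕ} (hj : n.totient < j) : (cyclotomic n ℤ).coeff j = 0 :=
  coeff_eq_zero_of_natDegree_lt (by rwa [natDegree_cyclotomic])

/-- The polynomial has degree at most that of the monic $\Phi_n$, so the cofactor is a constant,
read off at the leading term. -/
theorem eq_multiple_of_cyclotomic_dvd {γ : ℕ → ℤ} (hn : n.totient < n)
    (h0 : ∀ j < n, n.totient < j → γ j = 0) (hγ : cyclotomic n ℤ ∣ coeffPoly n γ) {j : ℕ}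
    (hj : j < n) : γ j = γ n.totient * (cyclotomic n ℤ).coeff j := by
  have hz : coeffPoly n γ - C (γ n.totient) * cyclotomic n ℤ = 0 := by
    refine eq_zero_of_dvd_of_degree_lt (dvd_sub hγ (dvd_mul_left _ _)) ?_
    rw [degree_cyclotomic, degree_lt_iff_coeff_zero]
    intro m hm
    rw [coeff_sub, coeff_C_mul, coeff_coeffPoly]
    rcases hm.eq_or_lt with rfl | hm
    · rw [if_pos hn, coeff_cyclotomic_totient, mul_one, sub_self]
    · rw [coeff_cyclotomic_eq_zero hm, mul_zero, sub_zero]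
      split_ifs with h
      · exact h0 m h hm
      · rfl
  have hcoeff := congrArg (fun f => coeff f j) (sub_eq_zero.mp hz)
  simpa [coeff_coeffPoly, hj] using hcoeff

theorem coeffPoly_cyclotomic (hn : n.totient < n) :
    coeffPoly n (cyclotomic n ℤ).coeff = cyclotomic n ℤ :=
  coeffPoly_coeff fun _ hj => coeff_cyclotomic_eq_zero (hn.trans_le hj)

theorem exists_reduced (γ : ℕ → ℤ) : ∃ γ' : ℕ → ℤ, (∀ j, n.totient ≤ j → γ' j = 0) ∧
    cyclotomic n ℤ ∣ coeffPoly n (γ - γ') := by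
  have hmonic := cyclotomic.monic n ℤ
  have h0 : ∀ j, n.totient ≤ j → (coeffPoly n γ %ₘ cyclotomic n ℤ).coeff j = 0 := by
    intro j hj
    refine coeff_eq_zero_of_degree_lt ((degree_modByMonic_lt _ hmonic).trans_le ?_)
    rw [degree_cyclotomic]
    exact_mod_cast hj
  refine ⟨_, h0, ?_⟩
  rw [coeffPoly_sub, coeffPoly_coeff fun j hj => h0 j ((Nat.totient_le n).trans hj)]
  nth_rewrite 1 [← modByMonic_add_div (coeffPoly n γ) (cyclotomic n ℤ)]
  rw [add_sub_cancel_left]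
  exact dvd_mul_right _ _

/-- The value on the residue of a polynomial modulo the `n`-th cyclotomic polynomial of the linear
form that takes the value `a j` on `X ^ j`. -/
def residueForm (n : ℕ) (a : ℕ → ℤ) (f : ℤ[X]) : ℤ :=
  ∑ j ∈ range n.totient, (f %ₘ cyclotomic n ℤ).coeff j * a j

theorem residueForm_sum (a : ℕ → ℤ) (s : Finset ℕ) (γ : ℕ → ℤ) :
    residueForm n a (∑ j ∈ s, C (γ j) * X ^ j) = ∑ j ∈ s, γ j * residueForm n a (X ^ j) := by
  have h : ∀ f, residueForm n a f =
      ∑ j ∈ range n.totient, (modByMonicHom (cyclotomic n ℤ) f).coeff j * a j := fun f => rfl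
  simp only [h, map_sum, C_mul', map_smul, finsetSum_coeff, coeff_smul, smul_eq_mul, sum_mul,
    mul_sum, mul_assoc]
  exact sum_comm

theorem residueForm_eq_zero (a : ℕ → ℤ) {f : ℤ[X]} (hf : cyclotomic n ℤ ∣ f) :
    residueForm n a f = 0 := by
  rw [residueForm, (modByMonic_eq_zero_iff_dvd (cyclotomic.monic n ℤ)).mpr hf]
  simp

/-- Below $\varphi(n)$ the power is its own remainder. At $\varphi(n)$ the form kills $\Phi_n$, and
`ha` says that `a` satisfies that very relation. -/
theorem residueForm_X_pow {a : ℕ → ℤ}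
    (ha : ∑ j ∈ range (n.totient + 1), (cyclotomic n ℤ).coeff j * a j = 0) {j : ℕ}
    (hj : j ≤ n.totient) : residueForm n a (X ^ j) = a j := by
  have hlt : ∀ j < n.totient, residueForm n a (X ^ j) = a j := by
    intro j hj
    have hdeg : (X ^ j : ℤ[X]).degree < (cyclotomic n ℤ).degree := by
      rw [degree_cyclotomic, degree_X_pow]
      exact_mod_cast hj
    rw [residueForm, (modByMonic_eq_self_iff (cyclotomic.monic n ℤ)).mpr hdeg,
      sum_eq_single_of_mem j (mem_range.mpr hj), coeff_X_pow_self, one_mul]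
    intro i _ hij
    rw [coeff_X_pow, if_neg hij, zero_mul]
  rcases hj.eq_or_lt with rfl | hj
  · have h0 := residueForm_eq_zero a (dvd_refl (cyclotomic n ℤ))
    nth_rewrite 1 [(cyclotomic n ℤ).as_sum_range_C_mul_X_pow] at h0
    rw [natDegree_cyclotomic, residueForm_sum, sum_range_succ,
      sum_congr rfl fun j hj => by rw [hlt j (mem_range.mp hj)],
      coeff_cyclotomic_totient, one_mul] at h0
    rw [sum_range_succ, coeff_cyclotomic_totient, one_mul] at ha
    exact add_left_cancel (h0.trans ha.symm)
  · exact hlt j hj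

end CyclotomicRelations

/-! ### Top cycles of the join. -/

section TopChains

variable {k : ℕ} {p : Fin (k + 1) → ℕ}

/-- The chain with coefficients `γ 0, …, γ (n - 1)` at the top simplices given by
`0, …, n - 1`. -/
def residueChain (p : Fin (k + 1) → ℕ) (γ : ℕ → ℤ) : Finset (Σₗ i, ZMod (p i)) →₀ ℤ :=
  ∑ j ∈ range (∏ i, p i), γ j • Finsupp.single (residueSimplex p j) 1

theorem linearCombination_residueChain (h : Finset (Σₗ i, ZMod (p i)) → ℤ) (γ : ℕ → ℤ) :
    Finsupp.linearCombination ℤ h (residueChain p γ) =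
      ∑ j ∈ range (∏ i, p i), γ j * h (residueSimplex p j) := by
  simp [residueChain]

theorem residueChain_mem (γ : ℕ → ℤ) :
    residueChain p γ ∈ chains (discreteJoin fun i => ZMod (p i)) k :=
  Submodule.sum_mem _ fun j _ => Submodule.smul_mem _ _
    (Finsupp.single_mem_supported ℤ 1 (residueSimplex_mem j))

theorem residueChain_apply (hp : ∀ i, (p i).Prime) (hinj : Function.Injective p) (γ : ℕ → ℤ)
    {j : ℕ} (hj : j < ∏ i, p i) : residueChain p γ (residueSimplex p j) = γ j := by
  rw [residueChain, Finsupp.finsetSum_apply, sum_eq_single_of_mem j (mem_range.mpr hj)]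
  · simp
  · intro j' hj' hne
    rw [Finsupp.smul_apply, Finsupp.single_eq_of_ne, smul_zero]
    exact fun h => hne (residueSimplex_injOn hp hinj (mem_range.mp hj') hj h.symm)

theorem topChain_ext (hp : ∀ i, (p i).Prime) (hinj : Function.Injective p)
    {f g : Finset (Σₗ i, ZMod (p i)) →₀ ℤ}
    (hf : f ∈ chains (discreteJoin fun i => ZMod (p i)) k)
    (hg : g ∈ chains (discreteJoin fun i => ZMod (p i)) k)
    (h : ∀ j < ∏ i, p i, f (residueSimplex p j) = g (residueSimplex p j)) : f = g := by
  ext s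
  by_cases hs : s ∈ simplices (discreteJoin fun i => ZMod (p i)) k
  · obtain ⟨j, hj, rfl⟩ := exists_residueSimplex_eq hp hinj hs
    exact h j hj
  · rw [(Finsupp.mem_supported' ℤ f).mp hf s hs, (Finsupp.mem_supported' ℤ g).mp hg s hs]

theorem linearCombination_topChain (hp : ∀ i, (p i).Prime) (hinj : Function.Injective p)
    {f : Finset (Σₗ i, ZMod (p i)) →₀ ℤ}
    (hf : f ∈ chains (discreteJoin fun i => ZMod (p i)) k)
    (h : Finset (Σₗ i, ZMod (p i)) → ℤ) :
    Finsupp.linearCombination ℤ h f =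
      ∑ j ∈ range (∏ i, p i), f (residueSimplex p j) * h (residueSimplex p j) := by
  rw [← linearCombination_residueChain h fun j => f (residueSimplex p j)]
  congr 1
  exact topChain_ext hp hinj hf (residueChain_mem _) fun j hj =>
    (residueChain_apply hp hinj (fun j => f (residueSimplex p j)) hj).symm

/-- The top cycles of the join are the functions on `ℤ / n` orthogonal to the relations between
the powers of a primitive `n`-th root of unity. -/
theorem boundary_eq_zero_iff (hp : ∀ i, (p i).Prime) (hinj : Function.Injective p)
    {f : Finset (Σₗ i, ZMod (p i)) →₀ ℤ}
    (hf : f ∈ chains (discreteJoin fun i => ZMod (p i)) k) :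
    boundary f = 0 ↔ ∀ γ : ℕ → ℤ, Polynomial.cyclotomic (∏ i, p i) ℤ ∣ coeffPoly (∏ i, p i) γ →
      ∑ j ∈ range (∏ i, p i), f (residueSimplex p j) * γ j = 0 := by
  constructor
  · intro h γ hγ
    obtain ⟨b, -, hb⟩ := (exists_faceSum_eq_iff hp hinj γ).mpr hγ
    refine (sum_congr rfl fun j hj => by rw [hb j (mem_range.mp hj)]).trans
      (linearCombination_topChain hp hinj hf (faceSum b)).symm |>.trans ?_
    rw [← linearCombination_boundary, h, map_zero]
  · intro h
    ext t
    -- The coefficient of the boundary at `t` is the pairing of `f` with the coboundary of the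
    -- indicator of `t`, which is a cyclotomic relation.
    have happly : ∀ g : Finset (Σₗ i, ZMod (p i)) →₀ ℤ,
        Finsupp.linearCombination ℤ (Pi.single t 1) g = g t := by
      intro g
      rw [Finsupp.linearCombination_apply, Finsupp.sum, sum_eq_single t]
      · simp
      · intro s _ hst
        simp [hst]
      · intro ht
        rw [Finsupp.notMem_support_iff.mp ht, zero_smul]
    rw [← happly, linearCombination_boundary, linearCombination_topChain hp hinj hf]
    exact h _ (cyclotomic_dvd_faceSum hp _)

/-- Such an `a` extends to a linear form on $\mathbb{Z}[X]/\Phi_n$; the values of the form on $X^j$,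
$j<n$, are orthogonal to all relations. -/
theorem exists_topCycle (hp : ∀ i, (p i).Prime) (hinj : Function.Injective p) {a : ℕ → ℤ}
    (hn : (∏ i, p i).totient < ∏ i, p i)
    (ha : ∑ j ∈ range ((∏ i, p i).totient + 1),
      (Polynomial.cyclotomic (∏ i, p i) ℤ).coeff j * a j = 0) :
    ∃ f ∈ chains (discreteJoin fun i => ZMod (p i)) k, boundary f = 0 ∧
      ∀ j ≤ (∏ i, p i).totient, f (residueSimplex p j) = a j := by
  set γ : ℕ → ℤ := fun j => residueForm (∏ i, p i) a (Polynomial.X ^ j) with hγ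
  refine ⟨residueChain p γ, residueChain_mem _, ?_, fun j hj => ?_⟩
  · rw [boundary_eq_zero_iff hp hinj (residueChain_mem _)]
    intro δ hδ
    rw [← residueForm_eq_zero a hδ, coeffPoly, residueForm_sum]
    exact sum_congr rfl fun j hj => by
      rw [residueChain_apply hp hinj _ (mem_range.mp hj), mul_comm]
  · rw [residueChain_apply hp hinj _ (hj.trans_lt hn)]
    exact residueForm_X_pow ha hj

/-- Pairing with the relation between $X^j$ and its remainder expresses the coefficient at `j`
through those below $\varphi(n)$. -/
theorem topCycle_eq_zero (hp : ∀ i, (p i).Prime) (hinj : Function.Injective p)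
    {f : Finset (Σₗ i, ZMod (p i)) →₀ ℤ}
    (hf : f ∈ chains (discreteJoin fun i => ZMod (p i)) k) (hf0 : boundary f = 0)
    (h : ∀ j < (∏ i, p i).totient, f (residueSimplex p j) = 0) : f = 0 := by
  refine topChain_ext hp hinj hf (Submodule.zero_mem _) fun j hj => ?_
  obtain ⟨γ', h0, hd⟩ := exists_reduced (n := ∏ i, p i) (Pi.single j 1)
  have hsum := (boundary_eq_zero_iff hp hinj hf).mp hf0 _ hd
  rw [sum_eq_single_of_mem j (mem_range.mpr hj)] at hsum
  · rcases lt_or_ge j (∏ i, p i).totient with hlt | hge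
    · exact h j hlt
    · simpa [h0 j hge] using hsum
  · intro i _ hij
    rcases lt_or_ge i (∏ i, p i).totient with hlt | hge
    · rw [h i hlt, zero_mul]
    · simp [h0 i hge, hij]

end TopChains

/-! ### Homology and cohomology of $K_A$. -/

section CyclotomicComplex

variable {k : ℕ} {p : Fin (k + 1) → ℕ} {A : Finset ℕ}

theorem totient_prod_lt (hp : ∀ i, (p i).Prime) : (∏ i, p i).totient < ∏ i, p i := by
  refine Nat.totient_lt _ ?_
  have hdvd : p 0 ∣ ∏ i, p i := dvd_prod_of_mem p (mem_univ 0)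
  exact (hp 0).one_lt.trans_le (Nat.le_of_dvd (prod_pos fun i _ => (hp i).pos) hdvd)

theorem simplices_cyclotomicComplex_of_lt {i : ℤ} (h : i < k) :
    simplices (cyclotomicComplex p A) i = simplices (discreteJoin fun i => ZMod (p i)) i :=
  simplices_balancedComplex_of_lt _ h

theorem simplices_cyclotomicComplex_top :
    simplices (cyclotomicComplex p A) k = residueSimplex p '' (A ∪ baseSet p : Finset ℕ) := by
  rw [cyclotomicComplex, simplices_balancedComplex_top, Set.image_image, Set.image_image]
  rfl

theorem simplices_cyclotomicComplex_top_subset :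
    simplices (cyclotomicComplex p A) k ⊆ simplices (discreteJoin fun i => ZMod (p i)) k := by
  rw [simplices_cyclotomicComplex_top]
  rintro _ ⟨j, -, rfl⟩
  exact residueSimplex_mem j

theorem cochains_cyclotomicComplex :
    cochains (cyclotomicComplex p A) ((k : ℤ) - 1) =
      cochains (discreteJoin fun i => ZMod (p i)) ((k : ℤ) - 1) :=
  cochains_eq_of_simplices_eq (simplices_cyclotomicComplex_of_lt (by omega))

theorem chains_cyclotomicComplex :
    chains (cyclotomicComplex p A) ((k : ℤ) - 1) =
      chains (discreteJoin fun i => ZMod (p i)) ((k : ℤ) - 1) :=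
  chains_eq_of_simplices_eq (simplices_cyclotomicComplex_of_lt (by omega))

theorem residueSimplex_mem_cyclotomicComplex_iff (hp : ∀ i, (p i).Prime)
    (hinj : Function.Injective p) (hA : ∀ j ∈ A, j ≤ (∏ i, p i).totient) {j : ℕ}
    (hj : j < ∏ i, p i) :
    residueSimplex p j ∈ simplices (cyclotomicComplex p A) k ↔
      j ∈ A ∨ (∏ i, p i).totient < j := by
  rw [simplices_cyclotomicComplex_top]
  constructor
  · rintro ⟨j', hj', h⟩
    rw [mem_coe, mem_union, baseSet, mem_Ioo] at hj'
    have hlt : j' < ∏ i, p i := by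
      rcases hj' with h | h
      · exact (hA j' h).trans_lt (totient_prod_lt hp)
      · exact h.2
    obtain rfl := residueSimplex_injOn hp hinj hlt hj h
    exact hj'.imp_right And.left
  · intro h
    refine ⟨j, ?_, rfl⟩
    rw [mem_coe, mem_union, baseSet, mem_Ioo]
    exact h.imp_right fun h => ⟨h, hj⟩

theorem forall_mem_simplices_top {P : Finset (Σₗ i, ZMod (p i)) → Prop}
    (h1 : ∀ j ∈ A, P (residueSimplex p j))
    (h2 : ∀ j < ∏ i, p i, (∏ i, p i).totient < j → P (residueSimplex p j)) :
    ∀ s ∈ simplices (cyclotomicComplex p A) k, P s := by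
  rw [simplices_cyclotomicComplex_top]
  rintro _ ⟨j, hj, rfl⟩
  rw [mem_coe, mem_union, baseSet, mem_Ioo] at hj
  exact hj.elim (h1 j) fun h => h2 j h.2 h.1

theorem mem_topChains_iff (hp : ∀ i, (p i).Prime) (hinj : Function.Injective p)
    (hA : ∀ j ∈ A, j ≤ (∏ i, p i).totient) {f : Finset (Σₗ i, ZMod (p i)) →₀ ℤ} :
    f ∈ chains (cyclotomicComplex p A) k ↔ f ∈ chains (discreteJoin fun i => ZMod (p i)) k ∧
      ∀ j ≤ (∏ i, p i).totient, j ∉ A → f (residueSimplex p j) = 0 := by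
  constructor
  · refine fun hf => ⟨Finsupp.supported_mono simplices_cyclotomicComplex_top_subset hf,
      fun j hj hjA => (Finsupp.mem_supported' ℤ f).mp hf _ fun h => ?_⟩
    rw [residueSimplex_mem_cyclotomicComplex_iff hp hinj hA
      (hj.trans_lt (totient_prod_lt hp))] at h
    exact h.elim hjA hj.not_gt
  · rintro ⟨hf, h⟩
    refine (Finsupp.mem_supported' ℤ f).mpr fun s hs => ?_
    by_cases hs' : s ∈ simplices (discreteJoin fun i => ZMod (p i)) k
    · obtain ⟨j, hj, rfl⟩ := exists_residueSimplex_eq hp hinj hs'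
      rw [residueSimplex_mem_cyclotomicComplex_iff hp hinj hA hj, not_or, not_lt] at hs
      exact h j hs.2 hs.1
    · exact (Finsupp.mem_supported' ℤ f).mp hf s hs'

theorem exists_cyclotomic_cochain (hp : ∀ i, (p i).Prime) (hinj : Function.Injective p) :
    ∃ b ∈ cochains (discreteJoin fun i => ZMod (p i)) ((k : ℤ) - 1), ∀ j < ∏ i, p i,
      faceSum b (residueSimplex p j) = (Polynomial.cyclotomic (∏ i, p i) ℤ).coeff j :=
  (exists_faceSum_eq_iff hp hinj _).mpr (by rw [coeffPoly_cyclotomic (totient_prod_lt hp)])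

theorem sum_range_mul_coeff_cyclotomic {n m : ℕ} (hA : ∀ j ∈ A, j ≤ n.totient)
    (hm : n.totient < m) {f : ℕ → ℤ} (hf : ∀ j ≤ n.totient, j ∉ A → f j = 0) :
    ∑ j ∈ range m, f j * (Polynomial.cyclotomic n ℤ).coeff j =
      ∑ j : A, f j * (Polynomial.cyclotomic n ℤ).coeff j := by
  rw [sum_coe_sort A fun j => f j * (Polynomial.cyclotomic n ℤ).coeff j]
  refine (sum_subset (fun j hj => mem_range.mpr ((hA j hj).trans_lt hm)) fun j _ hjA => ?_).symm
  rcases le_or_gt j n.totient with h | h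
  · rw [hf j h hjA, zero_mul]
  · rw [coeff_cyclotomic_eq_zero h, mul_zero]

theorem coeffGcd_dvd {j : ℕ} (hj : j ∈ A) :
    (coeffGcd p A : ℤ) ∣ (Polynomial.cyclotomic (∏ i, p i) ℤ).coeff j :=
  Int.natCast_dvd.mpr (gcd_dvd hj)

/-- Extension by zero of a function on `A`. -/
def extendZero (A : Finset ℕ) : (A → ℤ) →ₗ[ℤ] (ℕ → ℤ) :=
  Function.ExtendByZero.linearMap ℤ Subtype.val

theorem extendZero_coe (a : A → ℤ) (j : A) : extendZero A a j = a j :=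
  Subtype.val_injective.extend_apply a (0 : ℕ → ℤ) j

theorem extendZero_of_notMem (a : A → ℤ) {j : ℕ} (hj : j ∉ A) : extendZero A a j = 0 :=
  Function.extend_apply' a (0 : ℕ → ℤ) j fun ⟨i, hi⟩ => hj (hi ▸ i.2)

/-! ### Homology -/

/-- A cycle is $\partial w$ for a top chain $w$ of the join. Pairing it with a cochain whose
coboundary is $(c_j)$ gives $\sum_j w_jc_j$, and this modulo $d_A$ is the whole obstruction to
moving $w$ by a top cycle into $K_A$. -/
theorem reducedHomology_pred_equiv (hp : ∀ i, (p i).Prime) (hinj : Function.Injective p)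
    (hA : ∀ j ∈ A, j ≤ (∏ i, p i).totient) :
    Nonempty (ReducedHomology (cyclotomicComplex p A) ((k : ℤ) - 1) ≃+ ZMod (coeffGcd p A)) := by
  obtain ⟨b, -, hb⟩ := exists_cyclotomic_cochain hp hinj
  have hn := totient_prod_lt hp
  have hpair : ∀ w ∈ chains (discreteJoin fun i => ZMod (p i)) k,
      Finsupp.linearCombination ℤ b (boundary w) = ∑ j ∈ range (∏ i, p i),
        w (residueSimplex p j) * (Polynomial.cyclotomic (∏ i, p i) ℤ).coeff j := by
    intro w hw
    rw [linearCombination_boundary, linearCombination_topChain hp hinj hw]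
    exact sum_congr rfl fun j hj => by rw [hb j (mem_range.mp hj)]
  refine nonempty_reducedHomology_equiv ((Int.castAddHom (ZMod (coeffGcd p A))).toIntLinearMap ∘ₗ
    Finsupp.linearCombination ℤ b ∘ₗ Submodule.subtype _) (fun t => ?_) fun z => ?_
  · obtain ⟨t, rfl⟩ := ZMod.intCast_surjective t
    have hz : boundary (Finsupp.single (residueSimplex p (∏ i, p i).totient) 1) ∈
        cycles (cyclotomicComplex p A) ((k : ℤ) - 1) := by
      rw [mem_cycles_iff, chains_cyclotomicComplex]
      exact ⟨boundary_mem_chains (Finsupp.single_mem_supported ℤ 1 (residueSimplex_mem _)),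
        boundary_boundary _⟩
    -- The boundary of the simplex of $\varphi(n)$ pairs to the leading coefficient $1$.
    refine ⟨t • ⟨_, hz⟩, ?_⟩
    rw [map_smul, LinearMap.comp_apply, LinearMap.comp_apply, Submodule.subtype_apply,
      ← faceSum_eq, hb _ hn, coeff_cyclotomic_totient]
    simp
  · change ((Finsupp.linearCombination ℤ b z : ℤ) : ZMod (coeffGcd p A)) = 0 ↔ _
    rw [ZMod.intCast_zmod_eq_zero_iff_dvd, mem_boundaries_iff, sub_add_cancel]
    constructor
    · rintro ⟨m, hm⟩
      obtain ⟨hz, hz0⟩ := mem_cycles_iff.mp z.2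
      rw [chains_cyclotomicComplex] at hz
      obtain ⟨w, hw, hwz⟩ := discreteJoin_exact_chains (by omega) (mem_cycles_iff.mpr ⟨hz, hz0⟩)
      rw [sub_add_cancel] at hw
      obtain ⟨g, hg⟩ := gcd_eq_sum_mul A (Polynomial.cyclotomic (∏ i, p i) ℤ).coeff
      rw [← natCast_gcd_natAbs] at hg
      change (coeffGcd p A : ℤ) = _ at hg
      -- With Bézout coefficients $g$ on $A$, a cycle `f` agreeing with $w-mg$ up to $\varphi(n)$
      -- exists, and $w-f=mg$ there is supported on $A$.
      have hsum : ∑ j ∈ range ((∏ i, p i).totient + 1),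
          (Polynomial.cyclotomic (∏ i, p i) ℤ).coeff j *
            (w (residueSimplex p j) - m * extendZero A (fun j => g j) j) = 0 := by
        have h1 : ∑ j ∈ range ((∏ i, p i).totient + 1), w (residueSimplex p j) *
            (Polynomial.cyclotomic (∏ i, p i) ℤ).coeff j = coeffGcd p A * m := by
          rw [← hm, ← hwz, hpair w hw]
          refine sum_subset (range_subset_range.mpr hn) fun j _ hj => ?_
          rw [coeff_cyclotomic_eq_zero (by rw [mem_range] at hj; omega), mul_zero]
        have h2 := sum_range_mul_coeff_cyclotomic hA (Nat.lt_succ_self _)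
          (f := extendZero A fun j => g j) fun j _ hj => extendZero_of_notMem _ hj
        simp only [extendZero_coe] at h2
        rw [sum_coe_sort A fun j => g j * (Polynomial.cyclotomic (∏ i, p i) ℤ).coeff j] at h2
        simp only [mul_comm (g _), ← hg] at h2
        simp only [mul_sub, sum_sub_distrib]
        simp only [mul_comm _ (w _), h1, mul_left_comm _ m, ← mul_sum]
        simp only [mul_comm _ (extendZero A _ _), h2]
        ring
      obtain ⟨f, hf, hf0, hfa⟩ := exists_topCycle hp hinj hn hsum
      refine ⟨w - f, ?_, by rw [map_sub, hf0, hwz, sub_zero]⟩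
      refine (mem_topChains_iff hp hinj hA).mpr ⟨Submodule.sub_mem _ hw hf, fun j hj hjA => ?_⟩
      rw [Finsupp.sub_apply, hfa j hj, extendZero_of_notMem _ hjA]
      ring
    · rintro ⟨w, hw, hwz⟩
      rw [mem_topChains_iff hp hinj hA] at hw
      rw [← hwz, hpair w hw.1, sum_range_mul_coeff_cyclotomic hA hn hw.2]
      exact dvd_sum fun j _ => (coeffGcd_dvd j.2).mul_left _

/-- The isomorphism restricts a cycle to $A$: orthogonality to $\Phi_n$ puts it in the kernel,
`exists_topCycle` gives surjectivity, `topCycle_eq_zero` injectivity. -/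
theorem reducedHomology_top_equiv (hp : ∀ i, (p i).Prime) (hinj : Function.Injective p)
    (hA : ∀ j ∈ A, j ≤ (∏ i, p i).totient) :
    Nonempty (ReducedHomology (cyclotomicComplex p A) k ≃+ LinearMap.ker
      (Fintype.linearCombination ℤ fun j : A =>
        (Polynomial.cyclotomic (∏ i, p i) ℤ).coeff j)) := by
  have hn := totient_prod_lt hp
  let R : cycles (cyclotomicComplex p A) k →ₗ[ℤ] (A → ℤ) :=
    (LinearMap.pi fun j : A => Finsupp.lapply (residueSimplex p j)) ∘ₗ Submodule.subtype _
  have hR : ∀ (z : cycles (cyclotomicComplex p A) k) (j : A),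
      R z j = (z : Finset (Σₗ i, ZMod (p i)) →₀ ℤ) (residueSimplex p j) := fun _ _ => rfl
  refine nonempty_reducedHomology_equiv (R.codRestrict _ fun z => ?_) ?_ fun z => ?_
  · obtain ⟨hz, hz0⟩ := mem_cycles_iff.mp z.2
    rw [mem_topChains_iff hp hinj hA] at hz
    rw [LinearMap.mem_ker, Fintype.linearCombination_apply]
    simp only [hR, smul_eq_mul]
    rw [← sum_range_mul_coeff_cyclotomic hA hn hz.2]
    exact (boundary_eq_zero_iff hp hinj hz.1).mp hz0 _
      (by rw [coeffPoly_cyclotomic hn])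
  · rintro ⟨a, ha⟩
    rw [LinearMap.mem_ker, Fintype.linearCombination_apply] at ha
    have hsum := sum_range_mul_coeff_cyclotomic hA (Nat.lt_succ_self _) (f := extendZero A a)
      fun j _ hj => extendZero_of_notMem _ hj
    simp only [extendZero_coe] at hsum
    obtain ⟨f, hf, hf0, hfa⟩ := exists_topCycle hp hinj hn (a := extendZero A a)
      (by simpa only [mul_comm] using hsum.trans ha)
    refine ⟨⟨f, (mem_topChains_iff hp hinj hA).mpr ⟨hf, fun j hj hjA => ?_⟩, hf0⟩,
      Subtype.ext (funext fun j => ?_)⟩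
    · rw [hfa j hj, extendZero_of_notMem _ hjA]
    · exact (hfa j (hA j j.2)).trans (extendZero_coe a j)
  · have hbound : ∀ z, z ∈ boundaries (cyclotomicComplex p A) k ↔ z = 0 := by
      intro z
      rw [mem_boundaries_iff, chains, cyclotomicComplex,
        simplices_balancedComplex_of_gt _ (by omega), Finsupp.supported_empty]
      simp [eq_comm]
    rw [hbound]
    constructor
    · intro h
      obtain ⟨hz, hz0⟩ := mem_cycles_iff.mp z.2
      rw [mem_topChains_iff hp hinj hA] at hz
      refine topCycle_eq_zero hp hinj hz.1 hz0 fun j hj => ?_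
      by_cases hjA : j ∈ A
      · exact congrFun (congrArg Subtype.val h) ⟨j, hjA⟩
      · exact hz.2 j hj.le hjA
    · intro h
      rw [ZeroMemClass.coe_eq_zero.mp h, map_zero]

/-! ### Cohomology -/

theorem faceSum_cocycle (hp : ∀ i, (p i).Prime) {f : Finset (Σₗ i, ZMod (p i)) → ℤ}
    (hf : ∀ j < ∏ i, p i, (∏ i, p i).totient < j → faceSum f (residueSimplex p j) = 0)
    {j : ℕ} (hj : j < ∏ i, p i) :
    faceSum f (residueSimplex p j) = faceSum f (residueSimplex p (∏ i, p i).totient) *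
      (Polynomial.cyclotomic (∏ i, p i) ℤ).coeff j :=
  eq_multiple_of_cyclotomic_dvd (totient_prod_lt hp) hf (cyclotomic_dvd_faceSum hp f) hj

/-- Over the join, the coboundary of `f` is its value at $\varphi(n)$ times $(c_j)$. If this value
is zero, `f` is a cocycle of the join, where exactness applies. -/
theorem mem_coboundaries_pred (hp : ∀ i, (p i).Prime) (hinj : Function.Injective p)
    (hA : ∀ j ∈ A, j ≤ (∏ i, p i).totient) {f : Finset (Σₗ i, ZMod (p i)) → ℤ}
    (hf : f ∈ cocycles (cyclotomicComplex p A) ((k : ℤ) - 1)) :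
    f ∈ coboundaries (cyclotomicComplex p A) ((k : ℤ) - 1) ↔
      faceSum f (residueSimplex p (∏ i, p i).totient) = 0 := by
  rw [mem_cocycles_iff, sub_add_cancel] at hf
  rw [mem_coboundaries_iff hf.1, simplices_cyclotomicComplex_of_lt (by omega),
    cochains_eq_of_simplices_eq (simplices_cyclotomicComplex_of_lt (i := (k : ℤ) - 1 - 1)
    (by omega))]
  constructor
  · rintro ⟨b, -, hb⟩
    rw [← faceSum_faceSum b (residueSimplex p (∏ i, p i).totient), faceSum, faceSum]
    exact sum_congr rfl fun v hv => by rw [hb _ (erase_mem_simplices (residueSimplex_mem _) hv)]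
  · intro h
    refine discreteJoin_exact_cochains (by omega) fun t ht => ?_
    rw [sub_add_cancel] at ht
    obtain ⟨j, hj, rfl⟩ := exists_residueSimplex_eq hp hinj ht
    rw [faceSum_cocycle hp (fun j hj hlt => hf.2 _
      ((residueSimplex_mem_cyclotomicComplex_iff hp hinj hA hj).mpr (Or.inr hlt))) hj, h, zero_mul]

theorem reducedCohomology_pred_subsingleton (hp : ∀ i, (p i).Prime) (hinj : Function.Injective p)
    (hA : ∀ j ∈ A, j ≤ (∏ i, p i).totient) (hd : coeffGcd p A ≠ 0) :
    Subsingleton (ReducedCohomology (cyclotomicComplex p A) ((k : ℤ) - 1)) := by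
  refine reducedCohomology_subsingleton fun f hf => (mem_coboundaries_pred hp hinj hA hf).mpr ?_
  rw [mem_cocycles_iff, sub_add_cancel] at hf
  have hex : ∃ j ∈ A, (Polynomial.cyclotomic (∏ i, p i) ℤ).coeff j ≠ 0 := by
    by_contra! h
    exact hd (gcd_eq_zero_iff.mpr fun j hj => by rw [h j hj, Int.natAbs_zero])
  obtain ⟨j, hj, hc⟩ := hex
  have hjn := (hA j hj).trans_lt (totient_prod_lt hp)
  have hmul := faceSum_cocycle hp (fun j hj hlt => hf.2 _
      ((residueSimplex_mem_cyclotomicComplex_iff hp hinj hA hj).mpr (Or.inr hlt))) hjn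
  rw [hf.2 _ ((residueSimplex_mem_cyclotomicComplex_iff hp hinj hA hjn).mpr (Or.inl hj))] at hmul
  exact (mul_eq_zero.mp hmul.symm).resolve_right hc

theorem reducedCohomology_pred_equiv (hp : ∀ i, (p i).Prime) (hinj : Function.Injective p)
    (hA : ∀ j ∈ A, j ≤ (∏ i, p i).totient) (hd : coeffGcd p A = 0) :
    Nonempty (ReducedCohomology (cyclotomicComplex p A) ((k : ℤ) - 1) ≃+ ℤ) := by
  -- The coboundary is taken in the join: as $c_{\varphi(n)}=1$, `hd` forces $\varphi(n)\notin A$,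
  -- so this simplex is not in $K_A$.
  have hval : ∀ f, coboundary (discreteJoin fun i => ZMod (p i)) f
      (residueSimplex p (∏ i, p i).totient) =
      faceSum f (residueSimplex p (∏ i, p i).totient) :=
    fun f => coboundary_apply_of_mem f (residueSimplex_mem _)
  refine nonempty_reducedCohomology_equiv
    (LinearMap.proj (residueSimplex p (∏ i, p i).totient) ∘ₗ
      coboundary (discreteJoin fun i => ZMod (p i)) ∘ₗ Submodule.subtype _) (fun t => ?_) fun f => ?_
  · obtain ⟨b, hb, hbc⟩ := exists_cyclotomic_cochain hp hinj
    have hbK : b ∈ cocycles (cyclotomicComplex p A) ((k : ℤ) - 1) := by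
      rw [mem_cocycles_iff, cochains_cyclotomicComplex, sub_add_cancel]
      refine ⟨hb, forall_mem_simplices_top (fun j hj => ?_) fun j hj hlt => ?_⟩
      · rw [hbc j ((hA j hj).trans_lt (totient_prod_lt hp))]
        exact Int.natAbs_eq_zero.mp (gcd_eq_zero_iff.mp hd j hj)
      · rw [hbc j hj, coeff_cyclotomic_eq_zero hlt]
    refine ⟨t • ⟨b, hbK⟩, ?_⟩
    rw [map_smul, LinearMap.comp_apply, LinearMap.comp_apply, LinearMap.proj_apply,
      Submodule.subtype_apply, hval, hbc _ (totient_prod_lt hp), coeff_cyclotomic_totient]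
    simp
  · rw [mem_coboundaries_pred hp hinj hA f.2, ← hval]
    rfl

theorem residueCochain_mem_cocycles (a : A → ℤ) :
    residueCochain p (extendZero A a) ∈ cocycles (cyclotomicComplex p A) k := by
  refine mem_cocycles_iff.mpr ⟨fun s hs => sum_eq_zero fun j _ => ?_, ?_⟩
  · split_ifs with h
    · refine extendZero_of_notMem a fun hj => hs ?_
      rw [simplices_cyclotomicComplex_top]
      exact ⟨j, mem_coe.mpr (mem_union_left _ hj), h⟩
    · rfl
  · rw [cyclotomicComplex, simplices_balancedComplex_of_gt _ (by omega)]
    exact fun s hs => hs.elim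

/-- A function on `A` as a cocycle of top degree. -/
def topCocycle (p : Fin (k + 1) → ℕ) (A : Finset ℕ) :
    (A → ℤ) →ₗ[ℤ] cocycles (cyclotomicComplex p A) k where
  toFun a := ⟨residueCochain p (extendZero A a), residueCochain_mem_cocycles a⟩
  map_add' a a' := Subtype.ext (funext fun s => by
    simp [residueCochain, ← sum_add_distrib, ite_add_ite])
  map_smul' m a := Subtype.ext (funext fun s => by
    change residueCochain p (extendZero A (m • a)) s = m * residueCochain p (extendZero A a) s
    rw [map_smul]
    simp [residueCochain, mul_sum])

theorem topCocycle_apply (hp : ∀ i, (p i).Prime) (hinj : Function.Injective p) (a : A → ℤ)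
    {j : ℕ} (hj : j < ∏ i, p i) :
    (topCocycle p A a : Finset (Σₗ i, ZMod (p i)) → ℤ) (residueSimplex p j) =
      extendZero A a j :=
  residueCochain_apply hp hinj _ hj

/-- Reducing modulo $\Phi_n$ changes a cocycle by a coboundary and makes it vanish on $A_0$. -/
theorem topCocycle_class_surjective (hp : ∀ i, (p i).Prime) (hinj : Function.Injective p)
    (hA : ∀ j ∈ A, j ≤ (∏ i, p i).totient) :
    Function.Surjective (Submodule.mkQ ((coboundaries (cyclotomicComplex p A) k).submoduleOf
      (cocycles (cyclotomicComplex p A) k)) ∘ₗ topCocycle p A) := by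
  have hn := totient_prod_lt hp
  intro x
  obtain ⟨f, rfl⟩ := Submodule.mkQ_surjective _ x
  obtain ⟨γ', h0, hd⟩ := exists_reduced (n := ∏ i, p i) fun j =>
    (f : Finset (Σₗ i, ZMod (p i)) → ℤ) (residueSimplex p j)
  obtain ⟨b, hb, hbγ⟩ := (exists_faceSum_eq_iff hp hinj _).mpr hd
  refine ⟨fun j => γ' j, ?_⟩
  rw [LinearMap.comp_apply, ← sub_eq_zero, ← map_sub, Submodule.mkQ_apply,
    Submodule.Quotient.mk_eq_zero, ← neg_mem_iff, neg_sub]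
  refine (mem_coboundaries_iff (mem_cocycles_iff.mp (f - topCocycle p A fun j => γ' j).2).1).mpr
    ⟨b, by rwa [cochains_cyclotomicComplex], ?_⟩
  refine forall_mem_simplices_top (fun j hj => ?_) fun j hj hlt => ?_
  · have hjn := (hA j hj).trans_lt hn
    rw [hbγ j hjn, AddSubgroupClass.coe_sub, Pi.sub_apply, Pi.sub_apply,
      topCocycle_apply hp hinj _ hjn, extendZero_coe _ ⟨j, hj⟩]
  · rw [hbγ j hj, AddSubgroupClass.coe_sub, Pi.sub_apply, Pi.sub_apply,
      topCocycle_apply hp hinj _ hj, extendZero_of_notMem _ fun h => (hA j h).not_gt hlt,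
      h0 j hlt.le]

/-- A primitive has coboundary zero on $A_0$, so its coboundary over the join is a multiple of
$(c_j)$; conversely every multiple occurs. -/
theorem topCocycle_mem_coboundaries_iff (hp : ∀ i, (p i).Prime) (hinj : Function.Injective p)
    (hA : ∀ j ∈ A, j ≤ (∏ i, p i).totient) (a : A → ℤ) :
    (topCocycle p A a : Finset (Σₗ i, ZMod (p i)) → ℤ) ∈
        coboundaries (cyclotomicComplex p A) k ↔
      ∃ m : ℤ, ∀ j : A, a j = m * (Polynomial.cyclotomic (∏ i, p i) ℤ).coeff j := by
  have hn := totient_prod_lt hp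
  rw [mem_coboundaries_iff (mem_cocycles_iff.mp (topCocycle p A a).2).1,
    cochains_cyclotomicComplex]
  constructor
  · rintro ⟨b, -, hb⟩
    have hb' : ∀ j < ∏ i, p i, j ∈ A ∨ (∏ i, p i).totient < j →
        faceSum b (residueSimplex p j) = extendZero A a j := by
      intro j hj h
      rw [hb _ ((residueSimplex_mem_cyclotomicComplex_iff hp hinj hA hj).mpr h),
        topCocycle_apply hp hinj a hj]
    refine ⟨faceSum b (residueSimplex p (∏ i, p i).totient), fun j => ?_⟩
    have hjn := (hA j j.2).trans_lt hn
    rw [← faceSum_cocycle hp (fun j hj hlt => ?_) hjn, hb' j hjn (Or.inl j.2),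
      extendZero_coe]
    rw [hb' j hj (Or.inr hlt), extendZero_of_notMem _ fun h => (hA j h).not_gt hlt]
  · rintro ⟨m, hm⟩
    obtain ⟨b, hb, hbc⟩ := exists_cyclotomic_cochain hp hinj
    have hsmul : ∀ s, faceSum (m • b) s = m * faceSum b s := by
      intro s
      simp only [faceSum, mul_sum, Pi.smul_apply, smul_eq_mul, mul_left_comm]
    refine ⟨m • b, Submodule.smul_mem _ _ hb, ?_⟩
    refine forall_mem_simplices_top (fun j hj => ?_) fun j hj hlt => ?_
    · have hjn := (hA j hj).trans_lt hn
      rw [hsmul, hbc j hjn, topCocycle_apply hp hinj a hjn, extendZero_coe _ ⟨j, hj⟩, hm]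
    · rw [hsmul, hbc j hj, topCocycle_apply hp hinj a hj, coeff_cyclotomic_eq_zero hlt, mul_zero,
        extendZero_of_notMem _ fun h => (hA j h).not_gt hlt]

theorem reducedCohomology_top_equiv (hp : ∀ i, (p i).Prime) (hinj : Function.Injective p)
    (hA : ∀ j ∈ A, j ≤ (∏ i, p i).totient) (hne : A.Nonempty) :
    Nonempty (ReducedCohomology (cyclotomicComplex p A) k ≃+
      (Fin (A.card - 1) → ℤ) × ZMod (coeffGcd p A)) := by
  obtain ⟨F, hF, hker⟩ := exists_surjective_ker_eq_multiples hne
    (Polynomial.cyclotomic (∏ i, p i) ℤ).coeff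
  refine nonempty_addEquiv_of_ker_eq _ F (topCocycle_class_surjective hp hinj hA) hF fun a => ?_
  exact (Submodule.Quotient.mk_eq_zero _).trans
    ((topCocycle_mem_coboundaries_iff hp hinj hA a).trans (hker a).symm)

end CyclotomicComplex

end BalancedComplex

end

open BalancedComplex
theorem theorem1p3 (k : ℕ) (p : Fin (k + 1) → ℕ) (hp : ∀ i, (p i).Prime)
    (hinj : Function.Injective p) (A : Finset ℕ)
    (hA : ∀ j ∈ A, j ≤ Nat.totient (∏ i, p i)) :
    -- cohomology
    ((A.Nonempty → Nonempty (ReducedCohomology (cyclotomicComplex p A) k ≃+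
        (Fin (A.card - 1) → ℤ) × ZMod (coeffGcd p A))) ∧
      (A = ∅ → Subsingleton (ReducedCohomology (cyclotomicComplex p A) k)) ∧
      (coeffGcd p A = 0 →
        Nonempty (ReducedCohomology (cyclotomicComplex p A) ((k : ℤ) - 1) ≃+ ℤ)) ∧
      (coeffGcd p A ≠ 0 →
        Subsingleton (ReducedCohomology (cyclotomicComplex p A) ((k : ℤ) - 1))) ∧
      (∀ i : ℤ, i ≠ k → i ≠ (k : ℤ) - 1 →
        Subsingleton (ReducedCohomology (cyclotomicComplex p A) i))) ∧
    -- homology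
    (Nonempty (ReducedHomology (cyclotomicComplex p A) ((k : ℤ) - 1) ≃+ ZMod (coeffGcd p A)) ∧
      (coeffGcd p A = 0 →
        Nonempty (ReducedHomology (cyclotomicComplex p A) k ≃+ (Fin A.card → ℤ))) ∧
      (coeffGcd p A ≠ 0 →
        Nonempty (ReducedHomology (cyclotomicComplex p A) k ≃+ (Fin (A.card - 1) → ℤ))) ∧
      (∀ i : ℤ, i ≠ k → i ≠ (k : ℤ) - 1 →
        Subsingleton (ReducedHomology (cyclotomicComplex p A) i))) := by
  refine ⟨⟨reducedCohomology_top_equiv hp hinj hA, ?_, reducedCohomology_pred_equiv hp hinj hA,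
    reducedCohomology_pred_subsingleton hp hinj hA,
    fun i h1 h2 => balancedComplex_reducedCohomology_subsingleton _ h1 h2⟩,
    reducedHomology_pred_equiv hp hinj hA, fun hd => ?_, fun hd => ?_,
    fun i h1 h2 => balancedComplex_reducedHomology_subsingleton _ h1 h2⟩
  -- For empty $A$ the group is a quotient of the functions on the empty set.
  · rintro rfl
    exact (topCocycle_class_surjective hp hinj hA).subsingleton
  · obtain ⟨e⟩ := reducedHomology_top_equiv hp hinj hA
    have hker : LinearMap.ker (Fintype.linearCombination ℤ fun j : A =>
        (Polynomial.cyclotomic (∏ i, p i) ℤ).coeff j) = ⊤ := by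
      rw [eq_top_iff]
      intro a _
      rw [LinearMap.mem_ker, Fintype.linearCombination_apply]
      refine Finset.sum_eq_zero fun j _ => ?_
      rw [Int.natAbs_eq_zero.mp (Finset.gcd_eq_zero_iff.mp hd j j.2), smul_zero]
    exact ⟨e.trans ((LinearEquiv.ofTop _ hker).trans
      (LinearEquiv.funCongrLeft ℤ ℤ A.equivFin.symm)).toAddEquiv⟩
  · obtain ⟨e⟩ := reducedHomology_top_equiv hp hinj hA
    obtain ⟨e'⟩ := nonempty_orthogonal_equiv A (Polynomial.cyclotomic (∏ i, p i) ℤ).coeff hd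
    exact ⟨e.trans e'.toAddEquiv⟩
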